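/- Let $I$ be a finite set. A forest on $I$ is a set of rooted binary trees whose leaves are bijectively labelled by $I$; $V(F)$ denotes the set of inner vertices of the forest $F$. An inner orientation of $F$ consists of an orientation (a generator of the top exterior power) $o$ of $V(F)\sqcup\{R\}$, where $R$ is an auxiliary element, and of an orientation of the three half-edges at each inner vertex. Let $\operatorname{Bess}(I)$ be the $\mathbb{Q}$-vector space spanned by the inner-oriented forests $o\otimes F$ on $I$, reversing any one of the orientations being identified with multiplication by $-1$; it is graded by the number of inner vertices. The spaces $\operatorname{Bess}(I)$ form a graded operad (with Koszul signs), generated by $E_{i,j}$, symmetric of degree $0$, the forest on $\{i,j\}$ without inner vertex, and $\Omega_{i,j}$, antisymmetric of degree $1$, the tree on $\{i,j\}$ with one inner vertex $v$ and orientations $R\wedge v$ and $\mathrm{root}\wedge i\wedge j$. Acting with $E$ on two forests gives their disjoint union. Acting with $\Omega$ on two forests $F_1,F_2$ gives the sum, over all pairs of a tree $T_1$ of $F_1$ and a tree $T_2$ of $F_2$, of the forests obtained from $F_1\sqcup F_2$ by grafting $T_1$ and $T_2$ onto a new inner vertex $v$. The local orientations are $\mathrm{root}\wedge T_1\wedge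 T_2$ at $v$ and unchanged at the other vertices; if the global orientations of $F_1$, $F_2$ are $R\wedge\alpha_1$ and $R\wedge\alpha_2$, that of the result is $R\wedge\alpha_1\wedge\alpha_2$ for $E$ and $R\wedge v\wedge\alpha_1\wedge\alpha_2$ for $\Omega$. The coproduct $\Delta:\operatorname{Bess}\to\operatorname{Bess}\otimes\operatorname{Bess}$ is the morphism of graded operads with $$\Delta(E_{i,j})=E_{i,j}\otimes E_{i,j},\qquad \Delta(\Omega_{i,j})=E_{i,j}\otimes\Omega_{i,j}+\Omega_{i,j}\otimes E_{i,j}.$$ Let $\operatorname{Bess}^*(I)$ be the dual vector space of $\operatorname{Bess}(I)$, with the product $\langle\varphi\times\psi,x\rangle=\sum\langle\varphi,x'\rangle\langle\psi,x''\rangle$, where $\Delta(x)=\sum x'\otimes x''$. For distinct $i,j\in I$ let $Y_{i,j}\in\operatorname{Bess}^*(I)$ be the element of the dual basis given by the forest on $I$ with exactly one inner vertex $v$, which joins the leaves $i$ and $j$, with orientations $R\wedge v$ and $\mathrm{root}\wedge i\wedge j$. **Proposition.** Let $i,j,k,\ell$ be four distinct elements of $I$. Then, in $\operatorname{Bess}^*(I)$,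 $$\sum Y_{i_1,i_2}\times Y_{i_2,i_3}\times Y_{i_3,i_4}=0,$$ where the sum is over the set of total orders $i_1<i_2<i_3<i_4$ on $\{i,j,k,\ell\}$ up to reversal: it has $12$ terms, one for each pair formed by a total order and its reverse, and it vanishes for every choice of a representative in each pair. -/

import Mathlib

open scoped TensorProduct

noncomputable section

namespace Bessel


universe u

/-- Leaf-labelled rooted binary trees, drawn in the plane. The drawing is not part of the
structure of the tree; it records the local orientation `root ∧ left ∧ right` at every inner vertex, and (by
listing the inner vertices in prefix order) an order of the inner vertices. -/
inductive BTree (I : Type u) : Type u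
  | leaf : I → BTree I
  | node : BTree I → BTree I → BTree I
  deriving DecidableEq

variable {I : Type u}

/-- The degree: the number of inner vertices. -/
def BTree.deg : BTree I → ℕ
  | .leaf _ => 0
  | .node l r => 1 + l.deg + r.deg

/-- The leaves, with multiplicity. -/
def BTree.leaves : BTree I → Multiset I
  | .leaf i => {i}
  | .node l r => l.leaves + r.leaves

/-- A drawn forest `[T₁, …, Tₙ]`. It stands for the inner-oriented forest `o ⊗ {T₁, …, Tₙ}` with
global orientation `o = R ∧ v₁ ∧ ⋯ ∧ vₘ`, where `v₁, …, vₘ` are the inner vertices of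
`T₁`, then of `T₂`, …, each tree being read in prefix order (vertex, left branch, right branch),
and with local orientation `root ∧ left ∧ right` at each inner vertex. -/
abbrev Drawn (I : Type u) : Type u := List (BTree I)

/-- The degree of a drawn forest: its number of inner vertices. -/
def fdeg (w : Drawn I) : ℕ := (w.map BTree.deg).sum

/-- The leaves of a drawn forest, with multiplicity. -/
def fleaves (w : Drawn I) : Multiset I := (w.map BTree.leaves).sum

/-- The sign `(-1) ^ n`. -/
def sgn (n : ℕ) : ℚ := (-1) ^ n

/-- `TreeFlip c T T'`: the drawing `T'` is obtained from `T` by exchanging the two branches at one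
inner vertex. The inner orientations they carry differ by the sign `c`: the local orientation
at that vertex is reversed, and the inner vertices of the two branches are
exchanged in the global orientation. -/
inductive TreeFlip : ℚ → BTree I → BTree I → Prop
  | swap (l r : BTree I) : TreeFlip (-sgn (l.deg * r.deg)) (.node l r) (.node r l)
  | left {c : ℚ} {l l' : BTree I} (r : BTree I) :
      TreeFlip c l l' → TreeFlip c (.node l r) (.node l' r)
  | right {c : ℚ} (l : BTree I) {r r' : BTree I} :
      TreeFlip c r r' → TreeFlip c (.node l r) (.node l r')

/-- `Flip c w w'`: the drawings `w`, `w'` differ by one elementary move (exchange of two consecutive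
trees, or of the two branches at an inner vertex), so that they are drawings of the same forest,
and the inner orientations they carry differ by the sign `c`. -/
inductive Flip : ℚ → Drawn I → Drawn I → Prop
  | exch (t s : BTree I) (v : Drawn I) : Flip (sgn (t.deg * s.deg)) (t :: s :: v) (s :: t :: v)
  | tree {c : ℚ} {t t' : BTree I} (v : Drawn I) : TreeFlip c t t' → Flip c (t :: v) (t' :: v)
  | cons {c : ℚ} (t : BTree I) {v v' : Drawn I} : Flip c v v' → Flip c (t :: v) (t :: v')

/-! ### The action of the generators on forests, before orientations are identified -/

/-- Formal linear combinations of drawn forests. -/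
abbrev Lin (I : Type u) : Type u := Drawn I →₀ ℚ

/-- Formal linear combinations of pairs of drawn forests, `(a, b)` standing for `a ⊗ b`. -/
abbrev Lin2 (I : Type u) : Type u := (Drawn I × Drawn I) →₀ ℚ

/-- Bilinear extension of a map given on basis elements. -/
def bilin {α β M : Type*} [AddCommGroup M] [Module ℚ M] (f : α → β → M) :
    (α →₀ ℚ) →ₗ[ℚ] (β →₀ ℚ) →ₗ[ℚ] M :=
  Finsupp.linearCombination ℚ (fun a => Finsupp.linearCombination ℚ (f a))

/-- The disjoint union with a drawn forest `u` placed first. -/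
def pre (u : Drawn I) : Lin I →ₗ[ℚ] Lin I := Finsupp.lmapDomain ℚ ℚ (fun w => u ++ w)

/-- `Ω_{⋆,#} ∘_⋆ t ∘_# v` for a tree `t` and a forest `v`: the sum over all trees `s` of `v` of the
forest in which `s` is replaced by `t ∨ s`. -/
def graftTree (t : BTree I) : Drawn I → Lin I
  | [] => 0
  | s :: v => Finsupp.single (.node t s :: v) 1
      + sgn ((1 + t.deg) * s.deg) • pre [s] (graftTree t v)

/-- `Ω_{⋆,#} ∘_⋆ u ∘_# v` for two forests `u` and `v`: the sum over all pairs of a tree `t`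
of `u` and a tree `s` of `v` of the forest in which `t` and `s` are replaced by `t ∨ s`,
oriented by `(-1)^{o₁} o₁ ∧ o₂` modulo `R₁ ∧ R₂ = R ∧ vertex`. -/
def graft : Drawn I → Drawn I → Lin I
  | [], _ => 0
  | t :: u, v => sgn ((1 + t.deg) * fdeg u) • pre u (graftTree t v)
      + sgn t.deg • pre [t] (graft u v)

/-- The tensor product of two linear combinations. -/
def tens : Lin I →ₗ[ℚ] Lin I →ₗ[ℚ] Lin2 I := bilin fun a b => Finsupp.single (a, b) 1

/-- `(E ⊗ E) ∘_⋆ (x' ⊗ x'') ∘_# (y' ⊗ y'')`, with the Koszul sign. Here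
`E_{⋆,#} ∘_⋆ u ∘_# v` is the disjoint union `u ++ v`. -/
def opE : Lin2 I →ₗ[ℚ] Lin2 I →ₗ[ℚ] Lin2 I :=
  bilin fun x y => sgn (fdeg x.2 * fdeg y.1) • Finsupp.single (x.1 ++ y.1, x.2 ++ y.2) 1

/-- `(Ω ⊗ E + E ⊗ Ω) ∘_⋆ (x' ⊗ x'') ∘_# (y' ⊗ y'')`, with the Koszul signs. -/
def opOmega : Lin2 I →ₗ[ℚ] Lin2 I →ₗ[ℚ] Lin2 I :=
  bilin fun x y =>
    sgn (fdeg x.2 * fdeg y.1) •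
        tens (graft x.1 y.1) (Finsupp.single (x.2 ++ y.2) 1)
      + sgn (fdeg x.1 + (1 + fdeg x.2) * fdeg y.1) •
        tens (Finsupp.single (x.1 ++ y.1) 1) (graft x.2 y.2)

/-- The coproduct of a tree: the operad morphism with `Δ E = E ⊗ E` and
`Δ Ω = E ⊗ Ω + Ω ⊗ E` applied to the expression of the tree through `Ω` (and the unit of the
operad, on a single leaf). -/
def coprodTree : BTree I → Lin2 I
  | .leaf i => Finsupp.single ([.leaf i], [.leaf i]) 1
  | .node l r => opOmega (coprodTree l) (coprodTree r)

/-- The coproduct of a forest: the same operad morphism applied to the expression of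
the forest as an iterated `E` of its trees. -/
def coprodDrawn : Drawn I → Lin2 I
  | [] => Finsupp.single ([], []) 1
  | t :: w => opE (coprodTree t) (coprodDrawn w)

/-! ### Signs, degrees, leaves -/

theorem sgn_add (a b : ℕ) : sgn (a + b) = sgn a * sgn b := pow_add _ _ _

theorem sgn_or (a : ℕ) : sgn a = 1 ∨ sgn a = -1 := neg_one_pow_eq_or ℚ a

theorem sgn_mul (a b : ℕ) : sgn (a * b) = if sgn a = 1 then 1 else sgn b := by
  rcases sgn_or a with h | h
  · rw [if_pos h]; unfold sgn at *; rw [pow_mul, h, one_pow]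
  · rw [if_neg (by rw [h]; norm_num)]; unfold sgn at *; rw [pow_mul, h]

theorem sgn_mul' (a b : ℕ) : sgn (a * b) = sgn (b * a) := by rw [mul_comm]

@[simp] theorem fdeg_nil : fdeg ([] : Drawn I) = 0 := rfl
@[simp] theorem fdeg_cons (t : BTree I) (w : Drawn I) : fdeg (t :: w) = t.deg + fdeg w := by
  simp [fdeg]
@[simp] theorem fdeg_append (u w : Drawn I) : fdeg (u ++ w) = fdeg u + fdeg w := by
  simp [fdeg]

theorem TreeFlip.deg {c : ℚ} {t t' : BTree I} (h : TreeFlip c t t') : t.deg = t'.deg := by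
  induction h with
  | swap l r => simp only [BTree.deg]; omega
  | left r _ ih => simp only [BTree.deg, ih]
  | right l _ ih => simp only [BTree.deg, ih]

theorem TreeFlip.leaves {c : ℚ} {t t' : BTree I} (h : TreeFlip c t t') :
    t.leaves = t'.leaves := by
  induction h with
  | swap l r => simp only [BTree.leaves, add_comm]
  | left r _ ih => simp only [BTree.leaves, ih]
  | right l _ ih => simp only [BTree.leaves, ih]

theorem Flip.fdeg {c : ℚ} {w w' : Drawn I} (h : Flip c w w') : fdeg w = fdeg w' := by
  induction h with
  | exch t s v => simp only [fdeg_cons]; omega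
  | tree v h => simp only [fdeg_cons, h.deg]
  | cons t _ ih => simp only [fdeg_cons, ih]

theorem Flip.fleaves {c : ℚ} {w w' : Drawn I} (h : Flip c w w') : fleaves w = fleaves w' := by
  induction h with
  | exch t s v => simp only [Bessel.fleaves, List.map_cons, List.sum_cons]; rw [add_left_comm]
  | tree v h => simp only [Bessel.fleaves, List.map_cons, List.sum_cons, h.leaves]
  | cons t _ ih =>
    simp only [Bessel.fleaves, List.map_cons, List.sum_cons] at ih ⊢; rw [ih]

theorem Flip.append_left {c : ℚ} {w w' : Drawn I} (u : Drawn I) (h : Flip c w w') :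
    Flip c (u ++ w) (u ++ w') := by
  induction u with
  | nil => exact h
  | cons t u ih => exact .cons t ih

theorem Flip.append_right {c : ℚ} {w w' : Drawn I} (u : Drawn I) (h : Flip c w w') :
    Flip c (w ++ u) (w' ++ u) := by
  induction h with
  | exch t s v => exact .exch t s _
  | tree v h => exact .tree _ h
  | cons t _ ih => exact .cons t ih

/-! ### `Ω` respects the identification of orientations -/

/-- The identification of orientations, on linear combinations of drawn forests. -/
def rel (I : Type u) : Submodule ℚ (Lin I) :=
  Submodule.span ℚ {x | ∃ c w w', Flip c w w' ∧
    x = Finsupp.single w 1 - c • Finsupp.single w' 1}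

/-- Linear combinations of drawn forests modulo the identification of orientations. -/
abbrev Quo (I : Type u) : Type u := Lin I ⧸ rel I

/-- The class of a drawn forest. -/
def cl (w : Drawn I) : Quo I := (rel I).mkQ (Finsupp.single w 1)

theorem cl_flip {c : ℚ} {w w' : Drawn I} (h : Flip c w w') : cl w = c • cl w' := by
  unfold cl
  rw [← map_smul, ← sub_eq_zero, ← map_sub]
  exact (Submodule.Quotient.mk_eq_zero _).2 (Submodule.subset_span ⟨c, w, w', h, rfl⟩)

theorem quo_hom_ext {M : Type*} [AddCommGroup M] [Module ℚ M] {f g : Quo I →ₗ[ℚ] M}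
    (h : ∀ w, f (cl w) = g (cl w)) : f = g := by
  apply Submodule.linearMap_qext
  apply Finsupp.lhom_ext'
  intro w
  ext
  exact h w

theorem rel_le_ker {M : Type*} [AddCommGroup M] [Module ℚ M] (f : Lin I →ₗ[ℚ] M)
    (h : ∀ c w w', Flip c w w' → f (Finsupp.single w 1) = c • f (Finsupp.single w' 1)) :
    rel I ≤ LinearMap.ker f := by
  apply Submodule.span_le.2
  rintro _ ⟨c, w, w', hw, rfl⟩
  simp only [SetLike.mem_coe, LinearMap.mem_ker, map_sub, map_smul, h c w w' hw, sub_self]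

theorem pre_single (u w : Drawn I) :
    pre u (Finsupp.single w 1) = Finsupp.single (u ++ w) 1 := by
  simp [pre, Finsupp.lmapDomain_apply, Finsupp.mapDomain_single]

/-- `pre` on classes. -/
def preQ (u : Drawn I) : Quo I →ₗ[ℚ] Quo I :=
  (rel I).liftQ ((rel I).mkQ ∘ₗ pre u) (rel_le_ker _ fun c w w' h => by
    simp only [LinearMap.comp_apply, pre_single]
    exact cl_flip (h.append_left u))

theorem preQ_mk (u : Drawn I) (x : Lin I) : (rel I).mkQ (pre u x) = preQ u ((rel I).mkQ x) := rfl

theorem preQ_cl (u w : Drawn I) : preQ u (cl w) = cl (u ++ w) := by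
  unfold cl; rw [← preQ_mk, pre_single]

theorem preQ_append (u v : Drawn I) (x : Quo I) : preQ (u ++ v) x = preQ u (preQ v x) := by
  have : preQ (u ++ v) = preQ u ∘ₗ preQ v := quo_hom_ext fun w => by
    simp [preQ_cl]
  rw [this]; rfl

theorem preQ_cons (t : BTree I) (v : Drawn I) (x : Quo I) :
    preQ (t :: v) x = preQ [t] (preQ v x) := preQ_append [t] v x

theorem preQ_nil (x : Quo I) : preQ [] x = x := by
  have : preQ ([] : Drawn I) = LinearMap.id := quo_hom_ext fun w => by simp [preQ_cl]
  rw [this]; rfl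

theorem preQ_flip {c : ℚ} {u u' : Drawn I} (h : Flip c u u') (x : Quo I) :
    preQ u x = c • preQ u' x := by
  have : preQ u = c • preQ u' := quo_hom_ext fun w => by
    simp [preQ_cl, cl_flip (h.append_right w)]
  rw [this]; rfl

theorem preQ_exch (t s : BTree I) (x : Quo I) :
    preQ [t] (preQ [s] x) = sgn (t.deg * s.deg) • preQ [s] (preQ [t] x) := by
  rw [← preQ_append, ← preQ_append]; exact preQ_flip (.exch t s []) x

theorem preQ_exch_left (t : BTree I) (v : Drawn I) (x : Quo I) :
    preQ [t] (preQ v x) = sgn (t.deg * fdeg v) • preQ v (preQ [t] x) := by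
  induction v generalizing x with
  | nil => simp [preQ_nil, sgn]
  | cons s v ih =>
    rw [preQ_cons s v, preQ_cons s v, preQ_exch, ih, map_smul, smul_smul, fdeg_cons, mul_add,
      sgn_add]

theorem preQ_comm (u v : Drawn I) (x : Quo I) :
    preQ u (preQ v x) = sgn (fdeg u * fdeg v) • preQ v (preQ u x) := by
  induction u generalizing x with
  | nil => simp [preQ_nil, sgn]
  | cons t u ih =>
    rw [preQ_cons t u, preQ_cons t u, ih, map_smul, preQ_exch_left, smul_smul, fdeg_cons, add_mul,
      sgn_add, mul_comm]

theorem cl_cons (t : BTree I) (v : Drawn I) : cl (t :: v) = preQ [t] (cl v) := by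
  rw [preQ_cl]; rfl

theorem cl_comm (u v : Drawn I) : cl (u ++ v) = sgn (fdeg u * fdeg v) • cl (v ++ u) := by
  have := preQ_comm u v (cl [])
  simpa [preQ_cl] using this

theorem preQ_node (s t : BTree I) (v : Drawn I) : preQ [BTree.node s t] (cl v) =
    sgn ((1 + s.deg + t.deg) * fdeg v) • preQ v (cl [.node s t]) := by
  rw [preQ_cl, preQ_cl, cl_comm]; simp [BTree.deg]

/-- The class of `graftTree`. -/
def gT (t : BTree I) (v : Drawn I) : Quo I := (rel I).mkQ (graftTree t v)

/-- The class of `graft`. -/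
def gr (u v : Drawn I) : Quo I := (rel I).mkQ (graft u v)

theorem gT_nil (t : BTree I) : gT t [] = 0 := by simp [gT, graftTree]

theorem gT_cons (t s : BTree I) (v : Drawn I) :
    gT t (s :: v) = preQ [.node t s] (cl v)
      + sgn ((1 + t.deg) * s.deg) • preQ [s] (gT t v) := by
  unfold gT
  rw [graftTree, map_add, map_smul, preQ_mk, ← cl_cons]; rfl

theorem gr_nil (v : Drawn I) : gr [] v = 0 := by simp [gr, graft]

theorem gr_cons (t : BTree I) (u v : Drawn I) :
    gr (t :: u) v = sgn ((1 + t.deg) * fdeg u) • preQ u (gT t v)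
      + sgn t.deg • preQ [t] (gr u v) := by
  unfold gr gT
  rw [graft, map_add, map_smul, map_smul, preQ_mk, preQ_mk]

theorem gT_tree {c : ℚ} {t t' : BTree I} (h : TreeFlip c t t') (v : Drawn I) :
    gT t v = c • gT t' v := by
  induction v with
  | nil => simp [gT_nil]
  | cons s v ih =>
    rw [gT_cons, gT_cons, preQ_flip (.tree [] (h.left s)), ih, h.deg, map_smul, smul_add,
      smul_comm c]

theorem gT_flip (t : BTree I) {c : ℚ} {v v' : Drawn I} (h : Flip c v v') :
    gT t v = c • gT t v' := by
  induction h with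
  | exch a b v =>
    simp only [gT_cons, map_add, map_smul, cl_cons]
    rw [preQ_exch (.node t a) b, preQ_exch (.node t b) a, preQ_exch a b]
    simp only [smul_add, smul_smul, BTree.deg]
    have e1 : sgn (a.deg * b.deg) * (sgn ((1 + t.deg) * b.deg)) =
        sgn ((1 + t.deg + a.deg) * b.deg) := by
      rw [← sgn_add]; congr 1; ring
    have e2 : sgn (a.deg * b.deg) * sgn ((1 + t.deg + b.deg) * a.deg) =
        sgn ((1 + t.deg) * a.deg) := by
      rw [add_mul _ b.deg, sgn_add, mul_comm b.deg, mul_left_comm]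
      rcases sgn_or (a.deg * b.deg) with h | h <;> rw [h] <;> ring
    rw [e1, e2]
    rw [← e1]
    module
  | tree v h =>
    simp only [gT_cons]
    rw [preQ_flip (.tree [] (h.right t)), preQ_flip (.tree [] h), h.deg]
    module
  | cons s h ih =>
    simp only [gT_cons]
    rw [ih, cl_flip h]
    simp only [map_smul]
    module

theorem gr_flip_right (u : Drawn I) {c : ℚ} {v v' : Drawn I} (h : Flip c v v') :
    gr u v = c • gr u v' := by
  induction u with
  | nil => simp [gr_nil]
  | cons t u ih =>
    rw [gr_cons, gr_cons, ih, gT_flip t h]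
    simp only [map_smul]
    module

theorem gr_flip_left {c : ℚ} {u u' : Drawn I} (h : Flip c u u') (v : Drawn I) :
    gr u v = c • gr u' v := by
  induction h with
  | exch a b w =>
    simp only [gr_cons, map_add, map_smul, fdeg_cons, preQ_cons _ w, mul_add, sgn_add]
    rw [preQ_exch a b (gr w v)]
    simp only [smul_add, smul_smul, one_mul, mul_comm b.deg a.deg, add_mul, sgn_add]
    rcases sgn_or (a.deg * b.deg) with h | h <;> rw [h] <;> module
  | tree w h =>
    rw [gr_cons, gr_cons, gT_tree h, preQ_flip (.tree [] h), h.deg]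
    simp only [map_smul]
    module
  | cons t h ih =>
    rw [gr_cons, gr_cons, ih, preQ_flip h, h.fdeg]
    simp only [map_smul]
    module

theorem gr_singleton (v : Drawn I) (t : BTree I) :
    gr v [t] = -sgn (fdeg v * t.deg) • gT t v := by
  induction v with
  | nil => simp [gr_nil, gT_nil]
  | cons s v ih =>
    rw [gr_cons, gT_cons, ih, gT_cons, gT_nil, preQ_flip (.tree [] (.swap t s))]
    have e : preQ [BTree.node s t] (cl v) =
        sgn ((1 + s.deg + t.deg) * fdeg v) • preQ v (cl [.node s t]) :=
      preQ_node s t v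
    rw [e, cl_cons _ []]
    simp only [map_zero, smul_zero, add_zero, fdeg_cons, map_smul, smul_add, smul_smul, add_mul,
      one_mul, sgn_add, mul_comm t.deg s.deg, mul_comm t.deg (fdeg v)]
    rcases sgn_or (s.deg * t.deg) with h | h <;> rcases sgn_or (fdeg v * t.deg) with h' | h' <;>
      rw [h, h'] <;> module

theorem gr_cons_right (v : Drawn I) (t : BTree I) (u : Drawn I) :
    gr v (t :: u) = sgn ((1 + fdeg v + t.deg) * fdeg u) • preQ u (gr v [t])
      + sgn ((1 + fdeg v) * t.deg) • preQ [t] (gr v u) := by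
  induction v with
  | nil => simp [gr_nil]
  | cons s v ih =>
    have e : preQ [BTree.node s t] (cl u) =
        sgn ((1 + s.deg + t.deg) * fdeg u) • preQ u (cl [.node s t]) :=
      preQ_node s t u
    rw [gr_cons, gr_cons, gr_cons, ih, gT_cons, gT_cons, gT_nil, e, cl_cons _ []]
    simp only [map_add, map_smul, map_zero, smul_zero, add_zero]
    rw [preQ_comm v u, preQ_comm v [t], preQ_comm [s] u, preQ_comm [s] [t]]
    simp only [smul_add, smul_smul, fdeg_cons, fdeg_nil, add_zero, add_mul, mul_add, one_mul,
      sgn_add, mul_comm t.deg s.deg, mul_comm t.deg (fdeg v)]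
    rcases sgn_or (fdeg v * fdeg u) with h | h <;> rcases sgn_or (fdeg v * t.deg) with h' | h' <;>
      rcases sgn_or (s.deg * fdeg u) with h2 | h2 <;> rcases sgn_or (s.deg * t.deg) with h3 | h3 <;>
      rw [h, h', h2, h3] <;> module

theorem gr_antisymm (u v : Drawn I) : gr u v = -sgn (fdeg u * fdeg v) • gr v u := by
  induction u with
  | nil =>
    have : gr v [] = 0 := by
      induction v with
      | nil => exact gr_nil _
      | cons s v ih => rw [gr_cons, ih, gT_nil]; simp
    rw [this, gr_nil, smul_zero]
  | cons t u ih =>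
    rw [gr_cons_right, gr_cons, ih, gr_singleton]
    simp only [map_smul, smul_add, smul_smul, fdeg_cons, add_mul, one_mul, sgn_add,
      mul_comm t.deg (fdeg v), mul_comm (fdeg u) (fdeg v)]
    rcases sgn_or (fdeg v * fdeg u) with h | h <;> rcases sgn_or (fdeg v * t.deg) with h' | h' <;>
      rw [h, h'] <;> module

/-! ### The coproduct respects the identification of orientations -/

/-- The identification of orientations, on linear combinations of pairs. -/
def rel2 (I : Type u) : Submodule ℚ (Lin2 I) :=
  Submodule.span ℚ {x | ∃ c a a' b, Flip c a a' ∧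
    (x = Finsupp.single (a, b) 1 - c • Finsupp.single (a', b) 1 ∨
      x = Finsupp.single (b, a) 1 - c • Finsupp.single (b, a') 1)}

/-- Linear combinations of pairs modulo the identification of orientations. -/
abbrev Quo2 (I : Type u) : Type u := Lin2 I ⧸ rel2 I

theorem rel2_le_ker {M : Type*} [AddCommGroup M] [Module ℚ M] (f : Lin2 I →ₗ[ℚ] M)
    (h : ∀ c a a' b, Flip c a a' →
      f (Finsupp.single (a, b) 1) = c • f (Finsupp.single (a', b) 1) ∧
      f (Finsupp.single (b, a) 1) = c • f (Finsupp.single (b, a') 1)) :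
    rel2 I ≤ LinearMap.ker f := by
  apply Submodule.span_le.2
  rintro _ ⟨c, a, a', b, hw, rfl | rfl⟩
  · simp only [SetLike.mem_coe, LinearMap.mem_ker, map_sub, map_smul, (h c a a' b hw).1, sub_self]
  · simp only [SetLike.mem_coe, LinearMap.mem_ker, map_sub, map_smul, (h c a a' b hw).2, sub_self]

@[simp] theorem bilin_single {α β M : Type*} [AddCommGroup M] [Module ℚ M] (f : α → β → M)
    (a : α) (b : β) : bilin f (Finsupp.single a 1) (Finsupp.single b 1) = f a b := by
  simp [bilin]

theorem bilin_ext {α β M : Type*} [AddCommGroup M] [Module ℚ M]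
    {f g : (α →₀ ℚ) →ₗ[ℚ] (β →₀ ℚ) →ₗ[ℚ] M}
    (h : ∀ a b, f (Finsupp.single a 1) (Finsupp.single b 1) =
      g (Finsupp.single a 1) (Finsupp.single b 1)) : f = g := by
  apply Finsupp.lhom_ext'
  intro a
  ext1
  apply Finsupp.lhom_ext'
  intro b
  ext1
  exact h a b

theorem tens_single (a b : Drawn I) :
    tens (Finsupp.single a 1) (Finsupp.single b 1) = Finsupp.single (a, b) 1 :=
  bilin_single _ _ _

theorem mk2_flip {c : ℚ} {a a' : Drawn I} (b : Drawn I) (h : Flip c a a') :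
    (rel2 I).mkQ (Finsupp.single (a, b) 1) = c • (rel2 I).mkQ (Finsupp.single (a', b) 1) ∧
    (rel2 I).mkQ (Finsupp.single (b, a) 1) = c • (rel2 I).mkQ (Finsupp.single (b, a') 1) := by
  constructor
  · rw [← map_smul, ← sub_eq_zero, ← map_sub]
    exact (Submodule.Quotient.mk_eq_zero _).2
      (Submodule.subset_span ⟨c, a, a', b, h, .inl rfl⟩)
  · rw [← map_smul, ← sub_eq_zero, ← map_sub]
    exact (Submodule.Quotient.mk_eq_zero _).2
      (Submodule.subset_span ⟨c, a, a', b, h, .inr rfl⟩)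

/-- `tens` on classes, for a fixed drawn forest on the left. -/
def betaR (a : Drawn I) : Quo I →ₗ[ℚ] Quo2 I :=
  (rel I).liftQ ((rel2 I).mkQ ∘ₗ tens (Finsupp.single a 1)) (rel_le_ker _ fun c w w' h => by
    simp only [LinearMap.comp_apply, tens_single]
    exact (mk2_flip a h).2)

/-- `tens` on classes. -/
def beta : Quo I →ₗ[ℚ] Quo I →ₗ[ℚ] Quo2 I :=
  (rel I).liftQ (Finsupp.linearCombination ℚ betaR) (rel_le_ker _ fun c w w' h => by
    simp only [Finsupp.linearCombination_single, one_smul]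
    apply quo_hom_ext
    intro v
    have e : ∀ w : Drawn I, betaR w (cl v) = (rel2 I).mkQ (Finsupp.single (w, v) 1) := fun w => by
      rw [← tens_single]; rfl
    rw [LinearMap.smul_apply, e, e]
    exact (mk2_flip v h).1)

theorem beta_mk (x y : Lin I) :
    (rel2 I).mkQ (tens x y) = beta ((rel I).mkQ x) ((rel I).mkQ y) := by
  have : (tens (I := I)).compr₂ (rel2 I).mkQ = beta.compl₁₂ (rel I).mkQ (rel I).mkQ := by
    apply bilin_ext
    intro a b
    simp only [LinearMap.compr₂_apply, LinearMap.compl₁₂_apply]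
    have : beta ((rel I).mkQ (Finsupp.single a 1)) = betaR a := by
      change Finsupp.linearCombination ℚ betaR (Finsupp.single a 1) = betaR a
      simp
    rw [this]; rfl
  exact LinearMap.congr_fun₂ this x y

/-- The class of `opE`. -/
def qE : Lin2 I →ₗ[ℚ] Lin2 I →ₗ[ℚ] Quo2 I := opE.compr₂ (rel2 I).mkQ

/-- The class of `opOmega`. -/
def qO : Lin2 I →ₗ[ℚ] Lin2 I →ₗ[ℚ] Quo2 I := opOmega.compr₂ (rel2 I).mkQ

theorem qE_single (x y : Drawn I × Drawn I) :
    qE (Finsupp.single x 1) (Finsupp.single y 1) =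
      sgn (fdeg x.2 * fdeg y.1) • beta (cl (x.1 ++ y.1)) (cl (x.2 ++ y.2)) := by
  unfold cl
  rw [← beta_mk, tens_single, qE, LinearMap.compr₂_apply, opE, bilin_single, map_smul]

theorem qO_single (x y : Drawn I × Drawn I) :
    qO (Finsupp.single x 1) (Finsupp.single y 1) =
      sgn (fdeg x.2 * fdeg y.1) • beta (gr x.1 y.1) (cl (x.2 ++ y.2)) +
      sgn (fdeg x.1 + (1 + fdeg x.2) * fdeg y.1) • beta (cl (x.1 ++ y.1)) (gr x.2 y.2) := by
  unfold cl gr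
  rw [← beta_mk, ← beta_mk, qO, LinearMap.compr₂_apply, opOmega, bilin_single, map_add, map_smul,
    map_smul]

theorem lin2_hom_ext {M : Type*} [AddCommGroup M] [Module ℚ M] {f g : Lin2 I →ₗ[ℚ] M}
    (h : ∀ p, f (Finsupp.single p 1) = g (Finsupp.single p 1)) : f = g := by
  apply Finsupp.lhom_ext'
  intro p
  ext1
  exact h p

theorem congr_left {f : Lin2 I →ₗ[ℚ] Lin2 I →ₗ[ℚ] Quo2 I}
    (h : ∀ c a a' b y, Flip c a a' →
      f (Finsupp.single (a, b) 1) (Finsupp.single y 1) =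
        c • f (Finsupp.single (a', b) 1) (Finsupp.single y 1) ∧
      f (Finsupp.single (b, a) 1) (Finsupp.single y 1) =
        c • f (Finsupp.single (b, a') 1) (Finsupp.single y 1))
    {c : ℚ} {X X' : Lin2 I} (e : (rel2 I).mkQ X = c • (rel2 I).mkQ X') (Y : Lin2 I) :
    f X Y = c • f X' Y := by
  have hk : rel2 I ≤ LinearMap.ker f := rel2_le_ker _ fun c a a' b hw =>
    ⟨lin2_hom_ext fun y => (h c a a' b y hw).1, lin2_hom_ext fun y => (h c a a' b y hw).2⟩
  have hm : X - c • X' ∈ rel2 I := by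
    rw [← Submodule.Quotient.mk_eq_zero, ← Submodule.mkQ_apply, map_sub, map_smul, e, sub_self]
  have := LinearMap.congr_fun (LinearMap.mem_ker.1 (hk hm)) Y
  simpa [sub_eq_zero] using this

theorem congr_right {f : Lin2 I →ₗ[ℚ] Lin2 I →ₗ[ℚ] Quo2 I}
    (h : ∀ c a a' b y, Flip c a a' →
      f (Finsupp.single y 1) (Finsupp.single (a, b) 1) =
        c • f (Finsupp.single y 1) (Finsupp.single (a', b) 1) ∧
      f (Finsupp.single y 1) (Finsupp.single (b, a) 1) =
        c • f (Finsupp.single y 1) (Finsupp.single (b, a') 1))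
    {c : ℚ} {Y Y' : Lin2 I} (e : (rel2 I).mkQ Y = c • (rel2 I).mkQ Y') (X : Lin2 I) :
    f X Y = c • f X Y' :=
  congr_left (f := f.flip) h e X

theorem qE_congr_left {c : ℚ} {X X' : Lin2 I} (e : (rel2 I).mkQ X = c • (rel2 I).mkQ X')
    (Y : Lin2 I) : qE X Y = c • qE X' Y := by
  refine congr_left (fun c a a' b y h => ?_) e Y
  simp only [qE_single]
  rw [cl_flip (h.append_right y.1), cl_flip (h.append_right y.2), h.fdeg]
  simp only [map_smul, LinearMap.smul_apply]
  constructor <;> module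

theorem qE_congr_right {c : ℚ} {Y Y' : Lin2 I} (e : (rel2 I).mkQ Y = c • (rel2 I).mkQ Y')
    (X : Lin2 I) : qE X Y = c • qE X Y' := by
  refine congr_right (fun c a a' b y h => ?_) e X
  simp only [qE_single]
  rw [cl_flip (h.append_left y.1), cl_flip (h.append_left y.2), h.fdeg]
  simp only [map_smul, LinearMap.smul_apply]
  constructor <;> module

theorem qO_congr_left {c : ℚ} {X X' : Lin2 I} (e : (rel2 I).mkQ X = c • (rel2 I).mkQ X')
    (Y : Lin2 I) : qO X Y = c • qO X' Y := by
  refine congr_left (fun c a a' b y h => ?_) e Y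
  simp only [qO_single]
  rw [cl_flip (h.append_right y.1), cl_flip (h.append_right y.2), h.fdeg, gr_flip_left h y.1,
    gr_flip_left h y.2]
  simp only [map_smul, LinearMap.smul_apply]
  constructor <;> module

theorem qO_congr_right {c : ℚ} {Y Y' : Lin2 I} (e : (rel2 I).mkQ Y = c • (rel2 I).mkQ Y')
    (X : Lin2 I) : qO X Y = c • qO X Y' := by
  refine congr_right (fun c a a' b y h => ?_) e X
  simp only [qO_single]
  rw [cl_flip (h.append_left y.1), cl_flip (h.append_left y.2), h.fdeg, gr_flip_right y.1 h,
    gr_flip_right y.2 h]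
  simp only [map_smul, LinearMap.smul_apply]
  constructor <;> module

/-- The part of degree `n`. -/
def hom1 (I : Type u) (n : ℕ) : Submodule ℚ (Lin I) :=
  Submodule.span ℚ {x | ∃ w, fdeg w = n ∧ x = Finsupp.single w 1}

/-- The part of total degree `n`. -/
def hom2 (I : Type u) (n : ℕ) : Submodule ℚ (Lin2 I) :=
  Submodule.span ℚ {x | ∃ p : Drawn I × Drawn I, fdeg p.1 + fdeg p.2 = n ∧ x = Finsupp.single p 1}

theorem single_mem_hom1 (w : Drawn I) : Finsupp.single w 1 ∈ hom1 I (fdeg w) :=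
  Submodule.subset_span ⟨w, rfl, rfl⟩

theorem pre_mem (u : Drawn I) {n : ℕ} {x : Lin I} (hx : x ∈ hom1 I n) :
    pre u x ∈ hom1 I (fdeg u + n) := by
  have : hom1 I n ≤ (hom1 I (fdeg u + n)).comap (pre u) := by
    apply Submodule.span_le.2
    rintro _ ⟨w, rfl, rfl⟩
    rw [SetLike.mem_coe, Submodule.mem_comap, pre_single, ← fdeg_append]
    exact single_mem_hom1 _
  exact this hx

theorem graftTree_mem (t : BTree I) (v : Drawn I) :
    graftTree t v ∈ hom1 I (1 + t.deg + fdeg v) := by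
  induction v with
  | nil => exact Submodule.zero_mem _
  | cons s v ih =>
    refine Submodule.add_mem _ ?_ (Submodule.smul_mem _ _ ?_)
    · exact Submodule.subset_span ⟨_, by simp [BTree.deg, add_assoc], rfl⟩
    · have := pre_mem [s] ih
      convert this using 2
      simp; omega

theorem graft_mem (u v : Drawn I) : graft u v ∈ hom1 I (1 + fdeg u + fdeg v) := by
  induction u with
  | nil => exact Submodule.zero_mem _
  | cons t u ih =>
    refine Submodule.add_mem _ (Submodule.smul_mem _ _ ?_) (Submodule.smul_mem _ _ ?_)
    · convert pre_mem u (graftTree_mem t v) using 2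
      simp; omega
    · convert pre_mem [t] ih using 2
      simp; omega

theorem tens_mem {m n : ℕ} {x y : Lin I} (hx : x ∈ hom1 I m) (hy : y ∈ hom1 I n) :
    tens x y ∈ hom2 I (m + n) := by
  have h1 : ∀ a : Drawn I, fdeg a = m →
      hom1 I n ≤ (hom2 I (m + n)).comap (tens (Finsupp.single a 1)) := by
    intro a ha
    apply Submodule.span_le.2
    rintro _ ⟨w, rfl, rfl⟩
    rw [SetLike.mem_coe, Submodule.mem_comap, tens_single]
    exact Submodule.subset_span ⟨_, by simp [ha], rfl⟩
  have h2 : hom1 I m ≤ (hom2 I (m + n)).comap (tens.flip y) := by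
    apply Submodule.span_le.2
    rintro _ ⟨w, hw, rfl⟩
    exact h1 w hw hy
  exact h2 hx

theorem hom2_induction {m n : ℕ} {M : Type*} [AddCommGroup M] [Module ℚ M]
    (f : Lin2 I →ₗ[ℚ] Lin2 I →ₗ[ℚ] M) (S : Submodule ℚ M)
    (h : ∀ p q : Drawn I × Drawn I, fdeg p.1 + fdeg p.2 = m → fdeg q.1 + fdeg q.2 = n →
      f (Finsupp.single p 1) (Finsupp.single q 1) ∈ S)
    {X Y : Lin2 I} (hX : X ∈ hom2 I m) (hY : Y ∈ hom2 I n) : f X Y ∈ S := by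
  have h2 : hom2 I m ≤ S.comap (f.flip Y) := by
    apply Submodule.span_le.2
    rintro _ ⟨p, hp, rfl⟩
    have h1 : hom2 I n ≤ S.comap (f (Finsupp.single p 1)) := by
      apply Submodule.span_le.2
      rintro _ ⟨q, hq, rfl⟩
      exact h p q hp hq
    exact h1 hY
  exact h2 hX

theorem opOmega_mem {m n : ℕ} {X Y : Lin2 I} (hX : X ∈ hom2 I m) (hY : Y ∈ hom2 I n) :
    opOmega X Y ∈ hom2 I (1 + m + n) := by
  refine hom2_induction opOmega _ (fun p q hp hq => ?_) hX hY
  rw [opOmega, bilin_single]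
  refine Submodule.add_mem _ (Submodule.smul_mem _ _ ?_) (Submodule.smul_mem _ _ ?_)
  · convert tens_mem (graft_mem p.1 q.1) (single_mem_hom1 (p.2 ++ q.2)) using 2
    simp; omega
  · convert tens_mem (single_mem_hom1 (p.1 ++ q.1)) (graft_mem p.2 q.2) using 2
    simp; omega

theorem coprodTree_mem (t : BTree I) : coprodTree t ∈ hom2 I t.deg := by
  induction t with
  | leaf i => exact Submodule.subset_span ⟨_, by simp [BTree.deg], rfl⟩
  | node l r hl hr => exact opOmega_mem hl hr

theorem qO_antisymm {m n : ℕ} {X Y : Lin2 I} (hX : X ∈ hom2 I m) (hY : Y ∈ hom2 I n) :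
    qO X Y = -sgn (m * n) • qO Y X := by
  have := hom2_induction (qO + sgn (m * n) • qO.flip) ⊥ (fun p q hp hq => ?_) hX hY
  · rw [Submodule.mem_bot] at this
    simp only [LinearMap.add_apply, LinearMap.smul_apply, LinearMap.flip_apply] at this
    rw [neg_smul]; exact eq_neg_of_add_eq_zero_left this
  · rw [Submodule.mem_bot]
    simp only [LinearMap.add_apply, LinearMap.smul_apply, LinearMap.flip_apply]
    rw [qO_single, qO_single, gr_antisymm p.1, gr_antisymm p.2, cl_comm p.1, cl_comm p.2, ← hp, ← hq]
    simp only [map_smul, LinearMap.smul_apply, smul_add, smul_smul, add_mul, mul_add, one_mul,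
      sgn_add, mul_comm (fdeg q.2), mul_comm (fdeg q.1)]
    rcases sgn_or (fdeg p.1) with h1 | h1 <;> rcases sgn_or (fdeg p.2) with h2 | h2 <;>
      rcases sgn_or (fdeg q.1) with h3 | h3 <;> rcases sgn_or (fdeg q.2) with h4 | h4 <;>
      simp only [sgn_mul, h1, h2, h3, h4] <;> norm_num <;> abel

theorem opE_assoc (X Y Z : Lin2 I) : opE X (opE Y Z) = opE (opE X Y) Z := by
  have h : ∀ x y z : Drawn I × Drawn I,
      opE (Finsupp.single x 1) (opE (Finsupp.single y 1) (Finsupp.single z 1)) =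
      opE (opE (Finsupp.single x 1) (Finsupp.single y 1)) (Finsupp.single z 1) := by
    intro x y z
    simp only [opE, bilin_single, map_smul, LinearMap.smul_apply, smul_smul, fdeg_append, mul_add,
      add_mul, sgn_add, List.append_assoc]
    congr 1; ring
  have h2 : ∀ x y, (opE (Finsupp.single x 1)) ∘ₗ (opE (Finsupp.single y 1)) =
      opE (I := I) (opE (Finsupp.single x 1) (Finsupp.single y 1)) := fun x y =>
    lin2_hom_ext fun z => h x y z
  have h3 : ∀ x : Drawn I × Drawn I,
      (opE.compr₂ (opE (Finsupp.single x 1))).flip Z =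
        (opE.flip Z) ∘ₗ (opE (Finsupp.single x 1)) := fun x =>
    lin2_hom_ext fun y => LinearMap.congr_fun (h2 x y) Z
  have h4 : opE.flip (opE Y Z) = (opE.flip Z) ∘ₗ (opE.flip Y) :=
    lin2_hom_ext fun x => LinearMap.congr_fun (h3 x) Y
  exact LinearMap.congr_fun h4 X

theorem qE_comm {m n : ℕ} {X Y : Lin2 I} (hX : X ∈ hom2 I m) (hY : Y ∈ hom2 I n) :
    qE X Y = sgn (m * n) • qE Y X := by
  have := hom2_induction (qE - sgn (m * n) • qE.flip) ⊥ (fun p q hp hq => ?_) hX hY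
  · rw [Submodule.mem_bot] at this
    simp only [LinearMap.sub_apply, LinearMap.smul_apply, LinearMap.flip_apply] at this
    exact sub_eq_zero.1 this
  · rw [Submodule.mem_bot]
    simp only [LinearMap.sub_apply, LinearMap.smul_apply, LinearMap.flip_apply]
    rw [qE_single, qE_single, cl_comm p.1, cl_comm p.2, ← hp, ← hq]
    simp only [map_smul, LinearMap.smul_apply, smul_smul, add_mul, mul_add,
      sgn_add, mul_comm (fdeg q.2), mul_comm (fdeg q.1)]
    rcases sgn_or (fdeg p.1) with h1 | h1 <;> rcases sgn_or (fdeg p.2) with h2 | h2 <;>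
      rcases sgn_or (fdeg q.1) with h3 | h3 <;> rcases sgn_or (fdeg q.2) with h4 | h4 <;>
      simp only [sgn_mul, h1, h2, h3, h4] <;> norm_num

theorem coprodTree_flip {c : ℚ} {t t' : BTree I} (h : TreeFlip c t t') :
    (rel2 I).mkQ (coprodTree t) = c • (rel2 I).mkQ (coprodTree t') := by
  induction h with
  | swap l r => exact qO_antisymm (coprodTree_mem l) (coprodTree_mem r)
  | left r _ ih => exact qO_congr_left ih _
  | right l _ ih => exact qO_congr_right ih _

theorem coprodDrawn_flip {c : ℚ} {w w' : Drawn I} (h : Flip c w w') :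
    (rel2 I).mkQ (coprodDrawn w) = c • (rel2 I).mkQ (coprodDrawn w') := by
  induction h with
  | exch t s v =>
    simp only [coprodDrawn]
    rw [opE_assoc, opE_assoc]
    exact qE_congr_left (qE_comm (coprodTree_mem t) (coprodTree_mem s)) _
  | tree v h => exact qE_congr_left (coprodTree_flip h) _
  | cons t _ ih => exact qE_congr_right ih _

/-! ### The values of `Y` on drawn forests -/

/-- The value of `Y_{i,j}` on a drawn forest: a forest has one inner vertex and support `{i, j}` if
and only if its degree is one and it contains the tree with leaves `i` and `j`; this tree is
drawn with local orientation `root ∧ i ∧ j` or with the opposite orientation. -/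
def yVal [DecidableEq I] (i j : I) (w : Drawn I) : ℚ :=
  if fdeg w = 1 then
    (if BTree.node (.leaf i) (.leaf j) ∈ w then 1 else 0)
      - (if BTree.node (.leaf j) (.leaf i) ∈ w then 1 else 0)
  else 0

theorem deg_eq_zero {t : BTree I} (h : t.deg = 0) : ∃ a, t = .leaf a := by
  cases t with
  | leaf a => exact ⟨a, rfl⟩
  | node l r => simp [BTree.deg] at h

theorem flip_tree_one {c : ℚ} {t t' : BTree I} (h : TreeFlip c t t')
    (ht : t.deg = 1) : ∃ a b, c = -1 ∧ t = .node (.leaf a) (.leaf b) ∧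
      t' = .node (.leaf b) (.leaf a) := by
  cases h with
  | swap l r =>
    simp only [BTree.deg] at ht
    obtain ⟨a, rfl⟩ := deg_eq_zero (t := l) (by omega)
    obtain ⟨b, rfl⟩ := deg_eq_zero (t := r) (by omega)
    exact ⟨a, b, by simp [BTree.deg, sgn], rfl, rfl⟩
  | left r h =>
    simp only [BTree.deg] at ht
    rename_i l l'
    obtain ⟨a, rfl⟩ := deg_eq_zero (t := l) (by omega)
    cases h
  | right l h =>
    simp only [BTree.deg] at ht
    rename_i r r'
    obtain ⟨a, rfl⟩ := deg_eq_zero (t := r) (by omega)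
    cases h

theorem flip_zero {c : ℚ} {w w' : Drawn I} (h : Flip c w w') (hw : fdeg w = 0) : c = 1 := by
  induction h with
  | exch t s v =>
    rw [fdeg_cons] at hw
    have : t.deg = 0 := by omega
    simp [this, sgn]
  | @tree c t t' v h =>
    rw [fdeg_cons] at hw
    obtain ⟨a, rfl⟩ := deg_eq_zero (t := t) (by omega)
    cases h
  | cons t h ih =>
    rw [fdeg_cons] at hw
    exact ih (by omega)

theorem not_mem_of_fdeg {w : Drawn I} (h : fdeg w = 0) (a b : I) :
    BTree.node (.leaf a) (.leaf b) ∉ w := by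
  intro hm
  induction w with
  | nil => cases hm
  | cons s w ih =>
    rw [fdeg_cons] at h
    rcases List.mem_cons.1 hm with rfl | hm
    · simp [BTree.deg] at h
    · exact ih (by omega) hm

theorem yVal_flip [DecidableEq I] (i j : I) {c : ℚ} {w w' : Drawn I} (h : Flip c w w') :
    yVal i j w = c * yVal i j w' := by
  unfold yVal
  rw [← h.fdeg]
  by_cases hd : fdeg w = 1
  swap
  · rw [if_neg hd, if_neg hd, mul_zero]
  rw [if_pos hd, if_pos hd]
  induction h with
  | exch t s v =>
    simp only [fdeg_cons] at hd
    have : t.deg * s.deg = 0 := by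
      rcases Nat.eq_zero_or_pos t.deg with h | h
      · simp [h]
      · have : s.deg = 0 := by omega
        simp [this]
    rw [this]
    simp only [sgn, pow_zero, one_mul, List.mem_cons, or_left_comm]
  | @tree c t t' v h =>
    rw [fdeg_cons] at hd
    rcases Nat.eq_zero_or_pos t.deg with h0 | h0
    · obtain ⟨a, rfl⟩ := deg_eq_zero h0
      cases h
    · obtain ⟨a, b, rfl, rfl, rfl⟩ := flip_tree_one h (by omega)
      have hv : fdeg v = 0 := by omega
      simp only [List.mem_cons, not_mem_of_fdeg hv, or_false, BTree.node.injEq, BTree.leaf.injEq]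
      simp only [and_comm (a := j = a), and_comm (a := j = b)]
      ring
  | @cons c t v v' h ih =>
    rw [fdeg_cons] at hd
    rcases Nat.eq_zero_or_pos t.deg with h0 | h0
    · obtain ⟨a, rfl⟩ := deg_eq_zero h0
      have := ih (by simpa [BTree.deg] using hd)
      simpa using this
    · have hv : fdeg v = 0 := by omega
      have hv' : fdeg v' = 0 := h.fdeg ▸ hv
      simp [flip_zero h hv, not_mem_of_fdeg hv, not_mem_of_fdeg hv']

/-! ### The coalgebra `Bess(I)` and its dual algebra -/

section

variable [Fintype I]

/-- The drawn forests on the finite set `I`: every element of `I` labels exactly one leaf. -/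
def Forest (I : Type u) [Fintype I] : Type u :=
  {w : Drawn I // fleaves w = Finset.univ.val}

/-- The subspace spanned by the `o ⊗ F - c • (o' ⊗ F)` where `o = c • o'` are two inner
orientations of the same forest `F` on `I`. -/
def orientRel (I : Type u) [Fintype I] : Submodule ℚ (Forest I →₀ ℚ) :=
  Submodule.span ℚ {x | ∃ (c : ℚ) (w w' : Forest I), Flip c w.1 w'.1 ∧
    x = Finsupp.single w 1 - c • Finsupp.single w' 1}

/-- The vector space `Bess(I)`, spanned by the inner-oriented forests on `I`. -/
abbrev Bess (I : Type u) [Fintype I] : Type u := (Forest I →₀ ℚ) ⧸ orientRel I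

/-- The element of `Bess(I)` given by a drawn forest on `I`. -/
def ofForest (w : Forest I) : Bess I := (orientRel I).mkQ (Finsupp.single w 1)

open Classical in
/-- The element of `Bess(I)` given by a drawn forest if its set of leaves is `I`,
and `0` otherwise. -/
def ofDrawn (w : Drawn I) : Bess I :=
  if h : fleaves w = Finset.univ.val then ofForest ⟨w, h⟩ else 0

/-- The linear map `a ⊗ b ↦ a ⊗ b` from pairs of drawn forests to `Bess(I) ⊗ Bess(I)`. -/
def ofLin2 : Lin2 I →ₗ[ℚ] Bess I ⊗[ℚ] Bess I :=
  Finsupp.linearCombination ℚ fun p => ofDrawn p.1 ⊗ₜ[ℚ] ofDrawn p.2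

theorem ofForest_flip {c : ℚ} {w w' : Forest I} (h : Flip c w.1 w'.1) :
    ofForest w = c • ofForest w' := by
  unfold ofForest
  rw [← map_smul, ← sub_eq_zero, ← map_sub]
  exact (Submodule.Quotient.mk_eq_zero _).2 (Submodule.subset_span ⟨c, w, w', h, rfl⟩)

theorem ofDrawn_flip {c : ℚ} {w w' : Drawn I} (h : Flip c w w') :
    ofDrawn w = c • ofDrawn w' := by
  unfold ofDrawn
  by_cases hw : fleaves w = Finset.univ.val
  · have hw' : fleaves w' = Finset.univ.val := h.fleaves ▸ hw
    rw [dif_pos hw, dif_pos hw']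
    exact ofForest_flip h
  · have hw' : ¬ fleaves w' = Finset.univ.val := h.fleaves ▸ hw
    rw [dif_neg hw, dif_neg hw', smul_zero]

theorem rel2_le_ker_ofLin2 : rel2 I ≤ LinearMap.ker (ofLin2 (I := I)) :=
  rel2_le_ker _ fun c a a' b h => by
    simp only [ofLin2, Finsupp.linearCombination_single, one_smul]
    rw [ofDrawn_flip h, TensorProduct.smul_tmul', TensorProduct.tmul_smul]
    exact ⟨rfl, rfl⟩

theorem orientRel_le_ker {M : Type*} [AddCommGroup M] [Module ℚ M] (f : Forest I → M)
    (h : ∀ (c : ℚ) (w w' : Forest I), Flip c w.1 w'.1 → f w = c • f w') :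
    orientRel I ≤ LinearMap.ker (Finsupp.linearCombination ℚ f) := by
  apply Submodule.span_le.2
  rintro _ ⟨c, w, w', hw, rfl⟩
  simp [h c w w' hw]

theorem ofLin2_coprod_flip {c : ℚ} {w w' : Drawn I} (h : Flip c w w') :
    ofLin2 (coprodDrawn w) = c • ofLin2 (coprodDrawn w') := by
  have hm : coprodDrawn w - c • coprodDrawn w' ∈ rel2 I := by
    rw [← Submodule.Quotient.mk_eq_zero, ← Submodule.mkQ_apply, map_sub, map_smul,
      coprodDrawn_flip h, sub_self]
  have := LinearMap.mem_ker.1 (rel2_le_ker_ofLin2 hm)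
  simpa [sub_eq_zero] using this

/-- The coproduct `Δ : Bess(I) → Bess(I) ⊗ Bess(I)`. -/
def coprod (I : Type u) [Fintype I] : Bess I →ₗ[ℚ] Bess I ⊗[ℚ] Bess I :=
  (orientRel I).liftQ (Finsupp.linearCombination ℚ fun w => ofLin2 (coprodDrawn w.1))
    (orientRel_le_ker _ fun _ _ _ h => ofLin2_coprod_flip h)

/-- The dual vector space `Bess*(I)`. -/
abbrev BessDual (I : Type u) [Fintype I] : Type u := Module.Dual ℚ (Bess I)

/-- The product of `Bess*(I)`, the opposite of the product dual to the coproduct: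
`⟨φ × ψ, x⟩ = ∑ ⟨φ, x'⟩ ⟨ψ, x''⟩` where `Δ x = ∑ x' ⊗ x''`. -/
def times (φ ψ : BessDual I) : BessDual I :=
  LinearMap.mul' ℚ ℚ ∘ₗ TensorProduct.map φ ψ ∘ₗ coprod I

/-- The element `Y_{i,j}` of `Bess*(I)`: the element of the dual basis given by the forest on `I`
with one inner vertex `v` and support `{i, j}`, with global orientation `R ∧ v`
and local orientation `root ∧ i ∧ j`. -/
def Y [DecidableEq I] (i j : I) : BessDual I :=
  (orientRel I).liftQ (Finsupp.linearCombination ℚ fun w => yVal i j w.1)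
    (orientRel_le_ker _ fun _ _ _ h => yVal_flip i j h)

end

end Bessel

end

/-!
Attach to every inner vertex of a forest the vector `c(A, B)`, where `A` and `B` are the leaves of
its two branches and `c` is biadditive, and let the weight of the forest be the product of these
vectors in the exterior algebra. Grafting a tree multiplies weights by one more vector, which is
additive in `c`, so the coproduct turns into the addition of the maps `c`. Since `Y a b` reads off
the linear part of a weight, a product of three `Y`'s is, on a forest with three inner vertices, a
determinant: an alternating form in vectors `E a b`, whose coordinate at an inner vertex is `±1` if
that vertex is the last common ancestor of `a` and `b`, and `0` otherwise.

Among any leaves, at least two in number, there is a cherry: two of them, `c` and `c'`, with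
`E x c = E x c'` for all the others `x`. Exchanging `c` and `c'` in a path on four leaves only
changes the sign of `E c c'`. Hence the paths in which `c` and `c'` are adjacent cancel in pairs,
and in any other path two of the three vectors are proportional. When `c` and `c'` are the two
ends, the form is that of a triangle `x, y, c`, and one uses a cherry of these three leaves.
-/

noncomputable section

namespace Bessel

variable {I : Type*}

/-! ### Leaves of the terms of the coproduct -/

theorem apply_apply_mem_of_mem_supported {R α β M : Type*} [CommRing R] [AddCommGroup M]
    [Module R M] (S : Submodule R M) {s : Set α} {t : Set β}
    (B : (α →₀ R) →ₗ[R] (β →₀ R) →ₗ[R] M)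
    (h : ∀ a ∈ s, ∀ b ∈ t, B (Finsupp.single a 1) (Finsupp.single b 1) ∈ S)
    {x : α →₀ R} (hx : x ∈ Finsupp.supported R R s)
    {y : β →₀ R} (hy : y ∈ Finsupp.supported R R t) : B x y ∈ S := by
  rw [Finsupp.supported_eq_span_single] at hx hy
  refine LinearMap.BilinMap.apply_apply_mem_of_mem_span S _ _ B ?_ x y hx hy
  rintro _ ⟨a, ha, rfl⟩ _ ⟨b, hb, rfl⟩
  exact h a ha b hb

theorem apply_apply_eq_of_mem_supported {R α β M : Type*} [CommRing R] [AddCommGroup M]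
    [Module R M] {s : Set α} {t : Set β} {B B' : (α →₀ R) →ₗ[R] (β →₀ R) →ₗ[R] M}
    (h : ∀ a ∈ s, ∀ b ∈ t, B (Finsupp.single a 1) (Finsupp.single b 1) =
      B' (Finsupp.single a 1) (Finsupp.single b 1))
    {x : α →₀ R} (hx : x ∈ Finsupp.supported R R s)
    {y : β →₀ R} (hy : y ∈ Finsupp.supported R R t) : B x y = B' x y := by
  have hmem : (B - B') x y ∈ (⊥ : Submodule R M) :=
    apply_apply_mem_of_mem_supported ⊥ (B - B')
      (fun a ha b hb => (Submodule.mem_bot R).2 (sub_eq_zero.2 (h a ha b hb))) hx hy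
  exact sub_eq_zero.1 ((Submodule.mem_bot R).1 hmem)

@[simp] theorem fleaves_nil : fleaves ([] : Drawn I) = 0 := rfl

@[simp] theorem fleaves_cons (t : BTree I) (w : Drawn I) :
    fleaves (t :: w) = t.leaves + fleaves w := by simp [fleaves]

@[simp] theorem fleaves_append (u w : Drawn I) :
    fleaves (u ++ w) = fleaves u + fleaves w := by simp [fleaves]

/-- The linear combinations of drawn forests with leaves `A`. -/
def leafHom (A : Multiset I) : Submodule ℚ (Lin I) :=
  Finsupp.supported ℚ ℚ {w | fleaves w = A}

/-- The linear combinations of pairs of drawn forests which both have leaves `A`. -/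
def leafHom2 (A : Multiset I) : Submodule ℚ (Lin2 I) :=
  Finsupp.supported ℚ ℚ {p | fleaves p.1 = A ∧ fleaves p.2 = A}

theorem single_mem_leafHom {w : Drawn I} {A : Multiset I} (h : fleaves w = A) :
    Finsupp.single w 1 ∈ leafHom A :=
  Finsupp.single_mem_supported ℚ 1 h

theorem single_mem_leafHom2 {p : Drawn I × Drawn I} {A : Multiset I} (h₁ : fleaves p.1 = A)
    (h₂ : fleaves p.2 = A) : Finsupp.single p 1 ∈ leafHom2 A :=
  Finsupp.single_mem_supported ℚ 1 (show _ ∧ _ from ⟨h₁, h₂⟩)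

theorem pre_mem_leafHom (u : Drawn I) {A : Multiset I} {x : Lin I} (hx : x ∈ leafHom A) :
    pre u x ∈ leafHom (fleaves u + A) := by
  have himage : (fun w => u ++ w) '' {w | fleaves w = A} ⊆ {w | fleaves w = fleaves u + A} := by
    rintro _ ⟨w, rfl, rfl⟩
    exact fleaves_append u w
  exact Finsupp.supported_mono himage <|
    (Finsupp.lmapDomain_supported ℚ ℚ _ _).le (Submodule.mem_map_of_mem hx)

theorem graftTree_mem_leafHom (t : BTree I) (v : Drawn I) :
    graftTree t v ∈ leafHom (t.leaves + fleaves v) := by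
  induction v with
  | nil => exact Submodule.zero_mem _
  | cons s v ih =>
    refine Submodule.add_mem _ (single_mem_leafHom ?_) (Submodule.smul_mem _ _ ?_)
    · simp [BTree.leaves, add_assoc]
    · convert pre_mem_leafHom [s] ih using 2
      simp [add_left_comm]

theorem graft_mem_leafHom (u v : Drawn I) : graft u v ∈ leafHom (fleaves u + fleaves v) := by
  induction u with
  | nil => exact Submodule.zero_mem _
  | cons t u ih =>
    refine Submodule.add_mem _ (Submodule.smul_mem _ _ ?_) (Submodule.smul_mem _ _ ?_)
    · convert pre_mem_leafHom u (graftTree_mem_leafHom t v) using 2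
      simp [add_left_comm, add_assoc]
    · convert pre_mem_leafHom [t] ih using 2
      simp [add_assoc]

theorem tens_mem_leafHom2 {A : Multiset I} {x y : Lin I} (hx : x ∈ leafHom A)
    (hy : y ∈ leafHom A) : tens x y ∈ leafHom2 A := by
  refine apply_apply_mem_of_mem_supported _ tens (fun u hu v hv => ?_) hx hy
  rw [tens_single]
  exact single_mem_leafHom2 hu hv

theorem opE_mem_leafHom2 {A B : Multiset I} {X Y : Lin2 I} (hX : X ∈ leafHom2 A)
    (hY : Y ∈ leafHom2 B) : opE X Y ∈ leafHom2 (A + B) := by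
  refine apply_apply_mem_of_mem_supported _ opE ?_ hX hY
  rintro p ⟨rfl, hp⟩ q ⟨rfl, hq⟩
  rw [opE, bilin_single]
  exact Submodule.smul_mem _ _ (single_mem_leafHom2 (by simp) (by simp [hp, hq]))

theorem opOmega_mem_leafHom2 {A B : Multiset I} {X Y : Lin2 I} (hX : X ∈ leafHom2 A)
    (hY : Y ∈ leafHom2 B) : opOmega X Y ∈ leafHom2 (A + B) := by
  refine apply_apply_mem_of_mem_supported _ opOmega ?_ hX hY
  rintro p ⟨rfl, hp⟩ q ⟨rfl, hq⟩
  rw [opOmega, bilin_single]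
  refine Submodule.add_mem _ (Submodule.smul_mem _ _ (tens_mem_leafHom2 ?_ ?_))
    (Submodule.smul_mem _ _ (tens_mem_leafHom2 ?_ ?_))
  · exact graft_mem_leafHom _ _
  · exact single_mem_leafHom (by simp [hp, hq])
  · exact single_mem_leafHom (by simp)
  · rw [← hp, ← hq]
    exact graft_mem_leafHom _ _

theorem coprodTree_mem_leafHom2 (t : BTree I) : coprodTree t ∈ leafHom2 t.leaves := by
  induction t with
  | leaf i => exact single_mem_leafHom2 (by simp [BTree.leaves]) (by simp [BTree.leaves])
  | node l r hl hr => exact opOmega_mem_leafHom2 hl hr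

theorem coprodDrawn_mem_leafHom2 (w : Drawn I) : coprodDrawn w ∈ leafHom2 (fleaves w) := by
  induction w with
  | nil => exact single_mem_leafHom2 rfl rfl
  | cons t w ih =>
    rw [fleaves_cons]
    exact opE_mem_leafHom2 (coprodTree_mem_leafHom2 t) ih

/-! ### The exterior weight of a forest -/

/-- The leaves of the two branches at each inner vertex of a tree, in prefix order. -/
def BTree.nodes : BTree I → List (Multiset I × Multiset I)
  | .leaf _ => []
  | .node l r => (l.leaves, r.leaves) :: (l.nodes ++ r.nodes)

/-- The leaves of the two branches at each inner vertex of a drawn forest, in its order. -/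
def fnodes (w : Drawn I) : List (Multiset I × Multiset I) := w.flatMap BTree.nodes

@[simp] theorem fnodes_nil : fnodes ([] : Drawn I) = [] := rfl

@[simp] theorem fnodes_cons (t : BTree I) (w : Drawn I) :
    fnodes (t :: w) = t.nodes ++ fnodes w := rfl

@[simp] theorem fnodes_append (u w : Drawn I) : fnodes (u ++ w) = fnodes u ++ fnodes w :=
  List.flatMap_append

theorem BTree.length_nodes (t : BTree I) : t.nodes.length = t.deg := by
  induction t with
  | leaf i => rfl
  | node l r hl hr => simp only [nodes, deg, List.length_cons, List.length_append, hl, hr]; omega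

theorem length_fnodes (w : Drawn I) : (fnodes w).length = fdeg w := by
  induction w with
  | nil => rfl
  | cons t w ih => simp [ih, BTree.length_nodes]

section Weight

open ExteriorAlgebra

variable {N : Type*} [AddCommGroup N] [Module ℚ N]

/-- The exterior product of a list of vectors. -/
def wedge (L : List N) : ExteriorAlgebra ℚ N := (L.map (ι ℚ)).prod

@[simp] theorem wedge_nil : wedge ([] : List N) = 1 := rfl

@[simp] theorem wedge_cons (m : N) (L : List N) : wedge (m :: L) = ι ℚ m * wedge L := by
  simp [wedge]

@[simp] theorem wedge_append (L L' : List N) : wedge (L ++ L') = wedge L * wedge L' := by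
  simp [wedge]

theorem sgn_smul_wedge_mul_ι (L : List N) (m : N) :
    sgn L.length • (wedge L * ι ℚ m) = ι ℚ m * wedge L := by
  induction L with
  | nil => simp [sgn]
  | cons a L ih =>
    calc sgn (L.length + 1) • (wedge (a :: L) * ι ℚ m)
        = -(ι ℚ a * (sgn L.length • (wedge L * ι ℚ m))) := by
          simp [sgn, pow_succ, mul_assoc]
      _ = ι ℚ m * wedge (a :: L) := by
          rw [ih, ← mul_assoc, eq_neg_of_add_eq_zero_left (ι_add_mul_swap a m), neg_mul, neg_neg,
            wedge_cons, mul_assoc]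

theorem sgn_smul_wedge_mul_wedge (L L' : List N) :
    sgn (L.length * L'.length) • (wedge L' * wedge L) = wedge L * wedge L' := by
  induction L with
  | nil => simp [sgn]
  | cons a L ih =>
    calc sgn ((L.length + 1) * L'.length) • (wedge L' * wedge (a :: L))
        = sgn (L.length * L'.length) • ((sgn L'.length • (wedge L' * ι ℚ a)) * wedge L) := by
          rw [add_one_mul, sgn_add, mul_smul, wedge_cons, smul_mul_assoc, mul_assoc]
      _ = ι ℚ a * (sgn (L.length * L'.length) • (wedge L' * wedge L)) := by
          rw [sgn_smul_wedge_mul_ι, mul_assoc, mul_smul_comm]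
      _ = wedge (a :: L) * wedge L' := by rw [ih, wedge_cons, mul_assoc]

/-- The exterior product over the inner vertices of the vectors `c A B`, where `A` and `B` are the
leaves of the two branches. -/
def weight (c : Multiset I →+ Multiset I →+ N) (w : Drawn I) : ExteriorAlgebra ℚ N :=
  wedge ((fnodes w).map fun p => c p.1 p.2)

variable (c c' : Multiset I →+ Multiset I →+ N)

@[simp] theorem weight_nil : weight c [] = 1 := rfl

@[simp] theorem weight_leaf (i : I) : weight c [.leaf i] = 1 := rfl

theorem weight_append (u v : Drawn I) : weight c (u ++ v) = weight c u * weight c v := by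
  simp [weight]

theorem weight_cons (t : BTree I) (v : Drawn I) :
    weight c (t :: v) = weight c [t] * weight c v := weight_append c [t] v

theorem weight_node (l r : BTree I) :
    weight c [.node l r] = ι ℚ (c l.leaves r.leaves) * (weight c [l] * weight c [r]) := by
  simp [weight, BTree.nodes]

theorem sgn_smul_weight_mul_weight_mul (u v : Drawn I) (x : ExteriorAlgebra ℚ N) :
    sgn (fdeg u * fdeg v) • (weight c' v * (weight c u * x)) =
      weight c u * (weight c' v * x) := by
  have h := sgn_smul_wedge_mul_wedge ((fnodes u).map fun p => c p.1 p.2)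
    ((fnodes v).map fun p => c' p.1 p.2)
  rw [List.length_map, List.length_map, length_fnodes, length_fnodes] at h
  rw [← mul_assoc, ← mul_assoc, ← smul_mul_assoc]
  exact congrArg (· * x) h

theorem sgn_smul_weight_mul_ι_mul (v : Drawn I) (m : N) (x : ExteriorAlgebra ℚ N) :
    sgn (fdeg v) • (weight c v * (ι ℚ m * x)) = ι ℚ m * (weight c v * x) := by
  have h := sgn_smul_wedge_mul_ι ((fnodes v).map fun p => c p.1 p.2) m
  rw [List.length_map, length_fnodes] at h
  rw [← mul_assoc, ← mul_assoc, ← smul_mul_assoc]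
  exact congrArg (· * x) h

theorem sgn_smul_weight_mul_ι_mul_weight_mul (u v : Drawn I) (m : N) (x : ExteriorAlgebra ℚ N) :
    sgn ((1 + fdeg u) * fdeg v) • (weight c' v * (ι ℚ m * (weight c u * x))) =
      ι ℚ m * (weight c u * (weight c' v * x)) := by
  rw [one_add_mul, add_comm, sgn_add, mul_smul, sgn_smul_weight_mul_ι_mul, ← mul_smul_comm,
    sgn_smul_weight_mul_weight_mul]

/-- The linear extension of `weight`. -/
def weightLin : Lin I →ₗ[ℚ] ExteriorAlgebra ℚ N :=
  Finsupp.linearCombination ℚ (weight c)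

@[simp] theorem weightLin_single (w : Drawn I) :
    weightLin c (Finsupp.single w 1) = weight c w := by simp [weightLin]

theorem weightLin_pre (u : Drawn I) (x : Lin I) :
    weightLin c (pre u x) = weight c u * weightLin c x := by
  have : weightLin c ∘ₗ pre u = LinearMap.mulLeft ℚ (weight c u) ∘ₗ weightLin c := by
    ext w
    simp [pre_single, weight_append]
  exact LinearMap.congr_fun this x

theorem weightLin_graftTree (t : BTree I) (v : Drawn I) :
    weightLin c (graftTree t v) =
      ι ℚ (c t.leaves (fleaves v)) * (weight c [t] * weight c v) := by
  induction v with
  | nil => simp [graftTree]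
  | cons s v ih =>
    have hsign := sgn_smul_weight_mul_ι_mul_weight_mul c c [t] [s] (c t.leaves (fleaves v))
      (weight c v)
    simp only [fdeg_cons, fdeg_nil, add_zero] at hsign
    rw [graftTree, map_add, map_smul, weightLin_single, weightLin_pre, ih, hsign,
      weight_cons c (.node t s), weight_node, weight_cons c s v, fleaves_cons, map_add, map_add,
      add_mul, mul_assoc, mul_assoc]

theorem weightLin_graft (u v : Drawn I) :
    weightLin c (graft u v) =
      ι ℚ (c (fleaves u) (fleaves v)) * (weight c u * weight c v) := by
  induction u with
  | nil => simp [graft]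
  | cons t u ih =>
    have hsign₁ := sgn_smul_weight_mul_ι_mul_weight_mul c c [t] u (c t.leaves (fleaves v))
      (weight c v)
    have hsign₂ := sgn_smul_weight_mul_ι_mul c [t] (c (fleaves u) (fleaves v))
      (weight c u * weight c v)
    simp only [fdeg_cons, fdeg_nil, add_zero] at hsign₁ hsign₂
    rw [graft, map_add, map_smul, map_smul, weightLin_pre, weightLin_pre, weightLin_graftTree, ih,
      hsign₁, hsign₂, weight_cons c t u, fleaves_cons, map_add, AddMonoidHom.add_apply, map_add,
      add_mul, mul_assoc]

/-- The product of the weights of the two components of a pair of drawn forests, extended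
linearly. -/
def weight2 : Lin2 I →ₗ[ℚ] ExteriorAlgebra ℚ N :=
  Finsupp.linearCombination ℚ fun p => weight c p.1 * weight c' p.2

@[simp] theorem weight2_single (p : Drawn I × Drawn I) :
    weight2 c c' (Finsupp.single p 1) = weight c p.1 * weight c' p.2 := by simp [weight2]

theorem weight2_tens (x y : Lin I) :
    weight2 c c' (tens x y) = weightLin c x * weightLin c' y := by
  have : tens.compr₂ (weight2 c c') =
      (LinearMap.mul ℚ (ExteriorAlgebra ℚ N)).compl₁₂ (weightLin c) (weightLin c') :=
    bilin_ext fun u v => by simp [tens_single]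
  exact LinearMap.congr_fun₂ this x y

theorem weight2_opE (X Y : Lin2 I) :
    weight2 c c' (opE X Y) = weight2 c c' X * weight2 c c' Y := by
  have : opE.compr₂ (weight2 c c') =
      (LinearMap.mul ℚ (ExteriorAlgebra ℚ N)).compl₁₂ (weight2 c c') (weight2 c c') :=
    bilin_ext fun p q => by
      simp only [LinearMap.compr₂_apply, LinearMap.compl₁₂_apply, LinearMap.mul_apply', opE,
        bilin_single, map_smul, weight2_single, weight_append, mul_assoc]
      rw [← mul_smul_comm, sgn_smul_weight_mul_weight_mul]
  exact LinearMap.congr_fun₂ this X Y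

theorem weight2_opOmega_single (p q : Drawn I × Drawn I) :
    weight2 c c' (opOmega (Finsupp.single p 1) (Finsupp.single q 1)) =
      ι ℚ (c (fleaves p.1) (fleaves q.1)) *
          (weight c p.1 * weight c' p.2 * (weight c q.1 * weight c' q.2)) +
        ι ℚ (c' (fleaves p.2) (fleaves q.2)) *
          (weight c p.1 * weight c' p.2 * (weight c q.1 * weight c' q.2)) := by
  simp only [opOmega, bilin_single, map_add, map_smul, weight2_tens, weightLin_graft,
    weightLin_single, weight_append, mul_assoc]
  congr 1
  · rw [← mul_smul_comm, ← mul_smul_comm, sgn_smul_weight_mul_weight_mul]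
  · rw [sgn_add, mul_smul, ← mul_smul_comm, sgn_smul_weight_mul_ι_mul_weight_mul,
      sgn_smul_weight_mul_ι_mul]

theorem weight2_opOmega {A B : Multiset I} {X Y : Lin2 I} (hX : X ∈ leafHom2 A)
    (hY : Y ∈ leafHom2 B) :
    weight2 c c' (opOmega X Y) = ι ℚ ((c + c') A B) * (weight2 c c' X * weight2 c c' Y) := by
  have h := apply_apply_eq_of_mem_supported (B := opOmega.compr₂ (weight2 c c'))
    (B' := ((LinearMap.mul ℚ (ExteriorAlgebra ℚ N)).compl₁₂ (weight2 c c') (weight2 c c')).compr₂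
      (LinearMap.mulLeft ℚ (ι ℚ ((c + c') A B)))) ?_ hX hY
  · exact h
  · rintro p ⟨rfl, hp⟩ q ⟨rfl, hq⟩
    simp only [LinearMap.compr₂_apply, LinearMap.compl₁₂_apply, LinearMap.mul_apply',
      LinearMap.mulLeft_apply, weight2_opOmega_single, weight2_single, hp, hq,
      AddMonoidHom.add_apply, map_add, add_mul]

theorem weight2_coprodTree (t : BTree I) :
    weight2 c c' (coprodTree t) = weight (c + c') [t] := by
  induction t with
  | leaf i => simp [coprodTree]
  | node l r hl hr =>
    rw [coprodTree, weight2_opOmega c c' (coprodTree_mem_leafHom2 l) (coprodTree_mem_leafHom2 r),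
      hl, hr, weight_node]

theorem weight2_coprodDrawn (w : Drawn I) :
    weight2 c c' (coprodDrawn w) = weight (c + c') w := by
  induction w with
  | nil => simp [coprodDrawn]
  | cons t w ih => rw [coprodDrawn, weight2_opE, weight2_coprodTree, ih, ← weight_cons]

end Weight

/-! ### Products in the dual space -/

section Dual

variable [Fintype I]

theorem bessDual_ext {φ ψ : BessDual I} (h : ∀ w : Forest I, φ (ofForest w) = ψ (ofForest w)) :
    φ = ψ := by
  refine Submodule.linearMap_qext _ (Finsupp.lhom_ext' fun w => ?_)
  ext
  exact h w

theorem ofDrawn_eq_ofForest {w : Drawn I} (h : fleaves w = Finset.univ.val) :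
    ofDrawn w = ofForest ⟨w, h⟩ := dif_pos h

theorem times_ofForest (φ ψ : BessDual I) (w : Forest I) :
    times φ ψ (ofForest w) =
      Finsupp.linearCombination ℚ (fun p => φ (ofDrawn p.1) * ψ (ofDrawn p.2))
        (coprodDrawn w.1) := by
  have hcoprod : coprod I (ofForest w) = ofLin2 (coprodDrawn w.1) := by simp [coprod, ofForest]
  have heval : LinearMap.mul' ℚ ℚ ∘ₗ TensorProduct.map φ ψ ∘ₗ ofLin2 =
      Finsupp.linearCombination ℚ fun p => φ (ofDrawn p.1) * ψ (ofDrawn p.2) :=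
    lin2_hom_ext fun p => by simp [ofLin2]
  rw [← heval]
  simp [times, hcoprod]

theorem times_ofForest_eq_of_weight {N : Type*} [AddCommGroup N] [Module ℚ N]
    {c c' : Multiset I →+ Multiset I →+ N} {φ ψ : BessDual I} (f : ExteriorAlgebra ℚ N →ₗ[ℚ] ℚ)
    (h : ∀ u v : Forest I,
      f (weight c u.1 * weight c' v.1) = φ (ofForest u) * ψ (ofForest v)) (w : Forest I) :
    times φ ψ (ofForest w) = f (weight (c + c') w.1) := by
  rw [times_ofForest, ← weight2_coprodDrawn, weight2, Finsupp.apply_linearCombination,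
    Finsupp.linearCombination_apply, Finsupp.linearCombination_apply]
  refine Finsupp.sum_congr fun p hp => congrArg _ ?_
  obtain ⟨h₁, h₂⟩ := (Finsupp.mem_supported ℚ _).1 (coprodDrawn_mem_leafHom2 w.1) hp
  rw [ofDrawn_eq_ofForest (h₁.trans w.2), ofDrawn_eq_ofForest (h₂.trans w.2)]
  exact (h _ _).symm

end Dual

/-! ### Products of the elements `Y` as determinants -/

section TopForm

open ExteriorAlgebra

/-- The coefficient of the top exterior power of `ℚⁿ`. -/
def topForm (n : ℕ) : ExteriorAlgebra ℚ (Fin n → ℚ) →ₗ[ℚ] ℚ :=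
  liftAlternating (Pi.single n Matrix.detRowAlternating)

theorem topForm_wedge_ofFn (n m : ℕ) (v : Fin m → Fin n → ℚ) :
    topForm n (wedge (List.ofFn v)) =
      Pi.single (M := fun m => (Fin n → ℚ) [⋀^Fin m]→ₗ[ℚ] ℚ) n Matrix.detRowAlternating m v := by
  rw [topForm, ← liftAlternating_apply_ιMulti, ιMulti_apply, wedge, List.map_ofFn]
  rfl

theorem topForm_wedge_ofFn_self (n : ℕ) (v : Fin n → Fin n → ℚ) :
    topForm n (wedge (List.ofFn v)) = Matrix.det (Matrix.of v) := by
  rw [topForm_wedge_ofFn, Pi.single_eq_same]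
  rfl

theorem topForm_wedge_of_length_ne {n : ℕ} {L : List (Fin n → ℚ)} (h : L.length ≠ n) :
    topForm n (wedge L) = 0 := by
  rw [← List.ofFn_get L, topForm_wedge_ofFn, Pi.single_eq_of_ne h]
  rfl

theorem exists_alternatingMap_topForm_wedge_ofFn (n m : ℕ) :
    ∃ φ : (Fin m → ℚ) [⋀^Fin n]→ₗ[ℚ] ℚ, ∀ v : Fin n → Fin m → ℚ,
      topForm n (wedge (List.ofFn fun i j => v j i)) = φ v := by
  by_cases h : m = n
  · subst h
    refine ⟨Matrix.detRowAlternating, fun v => ?_⟩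
    rw [topForm_wedge_ofFn_self]
    exact Matrix.det_transpose _
  · exact ⟨0, fun v => topForm_wedge_of_length_ne (by rwa [List.length_ofFn])⟩

end TopForm

section Determinant

open ExteriorAlgebra

variable [DecidableEq I]

/-- The value of the edge `(a, b)` at an inner vertex: it is `±1` if that vertex is the last common
ancestor of `a` and `b`, and `0` otherwise. -/
def edgeVal (a b : I) (p : Multiset I × Multiset I) : ℚ :=
  p.1.count a * p.2.count b - p.1.count b * p.2.count a

theorem edgeVal_swap (a b : I) (p : Multiset I × Multiset I) : edgeVal b a p = -edgeVal a b p := by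
  simp only [edgeVal]; ring

/-- `edgeVal a b` times a vector, as a biadditive map. -/
def edgeHom {N : Type*} [AddCommGroup N] [Module ℚ N] (a b : I) (m : N) :
    Multiset I →+ Multiset I →+ N :=
  AddMonoidHom.mk'
    (fun A => AddMonoidHom.mk' (fun B => edgeVal a b (A, B) • m) fun B C => by
      simp only [edgeVal, Multiset.count_add, Nat.cast_add, ← add_smul]; congr 1; ring)
    fun A B => by
      ext C
      simp only [edgeVal, Multiset.count_add, Nat.cast_add, AddMonoidHom.mk'_apply,
        AddMonoidHom.add_apply, ← add_smul]
      congr 1; ring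

@[simp] theorem edgeHom_apply {N : Type*} [AddCommGroup N] [Module ℚ N] (a b : I) (m : N)
    (A B : Multiset I) : edgeHom a b m A B = edgeVal a b (A, B) • m := rfl

theorem yVal_of_fnodes_eq_singleton (a b : I) {w : Drawn I} {p : Multiset I × Multiset I}
    (h : fnodes w = [p]) : yVal a b w = edgeVal a b p := by
  have hdeg : fdeg w = 1 := by rw [← length_fnodes, h]; rfl
  rw [yVal, if_pos hdeg]
  induction w with
  | nil => simp at h
  | cons t w ih =>
    rw [fdeg_cons] at hdeg
    cases t with
    | leaf x => simpa using ih h (by simpa [BTree.deg] using hdeg)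
    | node l r =>
      simp only [BTree.deg] at hdeg
      obtain ⟨x, rfl⟩ := deg_eq_zero (t := l) (by omega)
      obtain ⟨y, rfl⟩ := deg_eq_zero (t := r) (by omega)
      have hw : fdeg w = 0 := by omega
      have hnodes : fnodes w = [] := by rw [← List.length_eq_zero_iff, length_fnodes, hw]
      obtain rfl : ({x}, {y}) = p := by simpa [BTree.nodes, BTree.leaves, hnodes] using h
      simp only [List.mem_cons, not_mem_of_fdeg hw, or_false, BTree.node.injEq,
        BTree.leaf.injEq, edgeVal, Multiset.count_singleton, ite_and, Nat.cast_ite, Nat.cast_one,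
        Nat.cast_zero, ite_zero_mul_ite_zero, mul_one]

theorem weight_edgeHom {N : Type*} [AddCommGroup N] [Module ℚ N] (a b : I) (m : N) (w : Drawn I) :
    weight (edgeHom a b m) w =
      algebraMap ℚ _ (if fdeg w = 0 then 1 else 0) + yVal a b w • ι ℚ m := by
  rw [← length_fnodes, weight]
  rcases h : fnodes w with _ | ⟨p, _ | ⟨q, L⟩⟩
  · have hy : yVal a b w = 0 := if_neg (by simp [← length_fnodes, h])
    simp [hy]
  · simp [yVal_of_fnodes_eq_singleton a b h]
  · have hy : yVal a b w = 0 := if_neg (by simp [← length_fnodes, h])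
    simp only [List.map_cons, wedge_cons, edgeHom_apply, map_smul, ← mul_assoc,
      smul_mul_smul_comm, ι_sq_zero, smul_zero, zero_mul]
    simp [hy]

theorem topForm_three_mul_mul (s t u x y z : ℚ) :
    topForm 3 ((algebraMap ℚ _ s + x • ι ℚ (Pi.single 0 1)) *
      (algebraMap ℚ _ t + y • ι ℚ (Pi.single 1 1)) *
      (algebraMap ℚ _ u + z • ι ℚ (Pi.single 2 1))) = x * y * z := by
  have h₀ : topForm 3 1 = 0 := topForm_wedge_of_length_ne (L := []) (by simp)
  have h₁ (m) : topForm 3 (ι ℚ m) = 0 := by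
    simpa using topForm_wedge_of_length_ne (L := [m]) (by simp)
  have h₂ (m n) : topForm 3 (ι ℚ m * ι ℚ n) = 0 := by
    simpa using topForm_wedge_of_length_ne (L := [m, n]) (by simp)
  have h₃ : topForm 3 (ι ℚ (Pi.single 0 1) * (ι ℚ (Pi.single 1 1) * ι ℚ (Pi.single 2 1))) = 1 := by
    have h := topForm_wedge_ofFn_self 3 fun i => Pi.single i 1
    have hone : (Matrix.of fun i : Fin 3 => Pi.single i (1 : ℚ)) = 1 := by
      ext i j; simp [Matrix.one_apply, Pi.single_apply, eq_comm]
    simpa [List.ofFn_succ, hone] using h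
  simp only [Algebra.algebraMap_eq_smul_one, add_mul, mul_add, smul_mul_assoc, mul_smul_comm,
    one_mul, mul_one, map_add, map_smul, h₀, h₁, h₂, h₃, mul_assoc, smul_eq_mul, mul_zero,
    zero_add, add_zero]
  ring

/-- The values of the edge `(a, b)` at the inner vertices of a drawn forest. -/
def edgeVec (w : Drawn I) (a b : I) (n : Fin (fnodes w).length) : ℚ :=
  edgeVal a b (fnodes w)[n]

theorem edgeVec_swap (w : Drawn I) (a b : I) : edgeVec w b a = -edgeVec w a b :=
  funext fun _ => edgeVal_swap a b _

variable [Fintype I]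

theorem Y_ofForest (a b : I) (w : Forest I) : Y a b (ofForest w) = yVal a b w.1 := by
  simp [Y, ofForest]

theorem topForm_three_weight_mul (a b c d : I) (s z : ℚ) (w : Forest I) :
    topForm 3 (weight (edgeHom a b (Pi.single 0 1) + edgeHom c d (Pi.single 1 1)) w.1 *
      (algebraMap ℚ _ s + z • ι ℚ (Pi.single 2 1))) =
      times (Y a b) (Y c d) (ofForest w) * z := by
  have h := times_ofForest_eq_of_weight (φ := Y a b) (ψ := z • Y c d)
    (c := edgeHom a b (Pi.single 0 1)) (c' := edgeHom c d (Pi.single 1 1))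
    (topForm 3 ∘ₗ LinearMap.mulRight ℚ (algebraMap ℚ _ s + z • ι ℚ (Pi.single 2 1)))
    (fun u v => ?_) w
  · rw [LinearMap.comp_apply, LinearMap.mulRight_apply] at h
    rw [← h]
    simp [times, TensorProduct.map_smul_right, mul_comm]
  · rw [LinearMap.comp_apply, LinearMap.mulRight_apply, weight_edgeHom, weight_edgeHom,
      topForm_three_mul_mul, LinearMap.smul_apply, Y_ofForest, Y_ofForest, smul_eq_mul]
    ring

theorem times_times_Y_ofForest (a b c d e f : I) (w : Forest I) :
    times (times (Y a b) (Y c d)) (Y e f) (ofForest w) =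
      topForm 3 (wedge ((fnodes w.1).map fun p =>
        ![edgeVal a b p, edgeVal c d p, edgeVal e f p])) := by
  rw [times_ofForest_eq_of_weight (topForm 3)
    (c := edgeHom a b (Pi.single 0 1) + edgeHom c d (Pi.single 1 1))
    (c' := edgeHom e f (Pi.single 2 1)) fun u v => ?_]
  · refine congrArg (fun f => topForm 3 (wedge ((fnodes w.1).map f))) (funext fun p => ?_)
    ext i
    fin_cases i <;> simp
  · rw [weight_edgeHom e f, topForm_three_weight_mul, Y_ofForest]

theorem exists_alternatingMap_times_times_Y (w : Forest I) :
    ∃ φ : (Fin (fnodes w.1).length → ℚ) [⋀^Fin 3]→ₗ[ℚ] ℚ, ∀ a b c d e f : I,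
      times (times (Y a b) (Y c d)) (Y e f) (ofForest w) =
        φ ![edgeVec w.1 a b, edgeVec w.1 c d, edgeVec w.1 e f] := by
  obtain ⟨φ, hφ⟩ := exists_alternatingMap_topForm_wedge_ofFn 3 (fnodes w.1).length
  refine ⟨φ, fun a b c d e f => ?_⟩
  rw [← hφ, times_times_Y_ofForest, ← List.ofFn_getElem_eq_map]
  refine congrArg (fun v => topForm 3 (wedge (List.ofFn v))) (funext fun n => funext fun i => ?_)
  fin_cases i <;> rfl

end Determinant

/-! ### Cherries -/

section Cherry

theorem BTree.mem_leaves_of_mem_nodes {t : BTree I} {p : Multiset I × Multiset I}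
    (hp : p ∈ t.nodes) {x : I} (hx : x ∈ p.1 + p.2) : x ∈ t.leaves := by
  induction t with
  | leaf i => simp [nodes] at hp
  | node l r hl hr =>
    rw [nodes, List.mem_cons, List.mem_append] at hp
    rw [leaves, Multiset.mem_add]
    rcases hp with rfl | hp | hp
    · exact Multiset.mem_add.1 hx
    · exact .inl (hl hp)
    · exact .inr (hr hp)

theorem mem_fleaves_of_mem_fnodes {w : Drawn I} {p : Multiset I × Multiset I}
    (hp : p ∈ fnodes w) {x : I} (hx : x ∈ p.1 + p.2) : x ∈ fleaves w := by
  induction w with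
  | nil => simp at hp
  | cons t w ih =>
    rw [fnodes_cons, List.mem_append] at hp
    rw [fleaves_cons, Multiset.mem_add]
    exact hp.imp (BTree.mem_leaves_of_mem_nodes · hx) ih

variable [DecidableEq I]

theorem edgeVal_congr_right {c c' : I} {p : Multiset I × Multiset I}
    (h₁ : p.1.count c = p.1.count c') (h₂ : p.2.count c = p.2.count c') (x : I) :
    edgeVal x c p = edgeVal x c' p := by
  rw [edgeVal, edgeVal, h₁, h₂]

theorem edgeVal_eq_zero_of_notMem {x : I} {p : Multiset I × Multiset I} (h : x ∉ p.1 + p.2)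
    (c : I) : edgeVal x c p = 0 := by
  rw [Multiset.mem_add, not_or] at h
  simp [edgeVal, Multiset.count_eq_zero_of_notMem h.1, Multiset.count_eq_zero_of_notMem h.2]

/-- The inner vertex `p` does not separate the leaves in `A`: each of its branches contains all of
them or none. -/
def NotSeparating (p : Multiset I × Multiset I) (A : Multiset I) : Prop :=
  ∀ a ∈ A, ∀ b ∈ A, p.1.count a = p.1.count b ∧ p.2.count a = p.2.count b

theorem notSeparating_of_disjoint {p : Multiset I × Multiset I} {A B : Multiset I}
    (hp : ∀ x ∈ p.1 + p.2, x ∈ B) (hAB : Disjoint A B) : NotSeparating p A := by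
  have hcount : ∀ a ∈ A, p.1.count a = 0 ∧ p.2.count a = 0 := fun a ha => by
    have h := mt (hp a) (Multiset.disjoint_left.1 hAB ha)
    rw [Multiset.mem_add, not_or] at h
    exact h.imp Multiset.count_eq_zero_of_notMem Multiset.count_eq_zero_of_notMem
  intro a ha b hb
  simp only [hcount a ha, hcount b hb, and_self]

theorem notSeparating_left {A B : Multiset I} (h : (A + B).Nodup) : NotSeparating (A, B) A := by
  obtain ⟨hA, -, hAB⟩ := Multiset.nodup_add.1 h
  intro a ha b hb
  have hB {x} (hx : x ∈ A) : B.count x = 0 :=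
    Multiset.count_eq_zero_of_notMem (Multiset.disjoint_left.1 hAB hx)
  simp only [Multiset.count_eq_one_of_mem hA, hB, ha, hb, and_self]

theorem notSeparating_right {A B : Multiset I} (h : (A + B).Nodup) : NotSeparating (A, B) B :=
  fun a ha b hb => (notSeparating_left (add_comm A B ▸ h) a ha b hb).symm

/-- The leaves `c` and `c'` form a cherry of the subforest induced on the set of leaves `K`: an
inner vertex from the list `L` which joins `c` to another element of `K` joins `c'` to it as well,
with the same orientation. -/
structure IsCherry (L : List (Multiset I × Multiset I)) (K : Finset I) (c c' : I) : Prop where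
  left_mem : c ∈ K
  right_mem : c' ∈ K
  ne : c ≠ c'
  edgeVal_eq : ∀ x ∈ K, x ≠ c → x ≠ c' → ∀ p ∈ L, edgeVal x c p = edgeVal x c' p

theorem IsCherry.of_filter {N L : List (Multiset I × Multiset I)} {A : Multiset I} {K : Finset I}
    {c c' : I} (h : IsCherry N (K.filter (· ∈ A)) c c') (hN : ∀ p ∈ N, ∀ x ∈ p.1 + p.2, x ∈ A)
    (hL : ∀ p ∈ L, p ∈ N ∨ NotSeparating p A) : IsCherry L K c c' := by
  obtain ⟨hcK, hcA⟩ := Finset.mem_filter.1 h.left_mem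
  obtain ⟨hcK', hcA'⟩ := Finset.mem_filter.1 h.right_mem
  refine ⟨hcK, hcK', h.ne, fun x hx hxc hxc' p hp => ?_⟩
  rcases hL p hp with hpN | hsep
  · by_cases hxA : x ∈ A
    · exact h.edgeVal_eq x (Finset.mem_filter.2 ⟨hx, hxA⟩) hxc hxc' p hpN
    · have hxp : x ∉ p.1 + p.2 := mt (hN p hpN x) hxA
      rw [edgeVal_eq_zero_of_notMem hxp, edgeVal_eq_zero_of_notMem hxp]
  · obtain ⟨h₁, h₂⟩ := hsep c hcA c' hcA'
    exact edgeVal_congr_right h₁ h₂ x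

/-- Every set of at least two elements of `A` has a cherry with respect to the inner vertices
`L`. -/
def HasCherries (L : List (Multiset I × Multiset I)) (A : Multiset I) : Prop :=
  ∀ K : Finset I, K.Nontrivial → (∀ x ∈ K, x ∈ A) → ∃ c c', IsCherry L K c c'

theorem HasCherries.add {N N' L : List (Multiset I × Multiset I)} {A B : Multiset I}
    (hA : HasCherries N A) (hB : HasCherries N' B)
    (hN : ∀ p ∈ N, ∀ x ∈ p.1 + p.2, x ∈ A) (hN' : ∀ p ∈ N', ∀ x ∈ p.1 + p.2, x ∈ B)
    (hAL : ∀ p ∈ L, p ∈ N ∨ NotSeparating p A) (hBL : ∀ p ∈ L, p ∈ N' ∨ NotSeparating p B) :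
    HasCherries L (A + B) := by
  intro K hK hKAB
  by_cases hKA : (K.filter (· ∈ A)).Nontrivial
  · obtain ⟨c, c', h⟩ := hA _ hKA fun x hx => (Finset.mem_filter.1 hx).2
    exact ⟨c, c', h.of_filter hN hAL⟩
  by_cases hKB : (K.filter (· ∈ B)).Nontrivial
  · obtain ⟨c, c', h⟩ := hB _ hKB fun x hx => (Finset.mem_filter.1 hx).2
    exact ⟨c, c', h.of_filter hN' hBL⟩
  -- Now `K` has at most one element in `A` and at most one in `B`, so it is a pair.
  obtain ⟨c, hc, c', hc', hne⟩ := hK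
  rw [Finset.Nontrivial, Set.not_nontrivial_iff] at hKA hKB
  refine ⟨c, c', hc, hc', hne, fun x hx hxc hxc' => absurd hne ?_⟩
  have hsame {y z} (hy : y ∈ K) (hz : z ∈ K) (h : y ∈ A ∧ z ∈ A ∨ y ∈ B ∧ z ∈ B) : y = z := by
    rcases h with h | h
    · exact hKA (by simp [hy, h.1]) (by simp [hz, h.2])
    · exact hKB (by simp [hy, h.1]) (by simp [hz, h.2])
  have := Multiset.mem_add.1 (hKAB c hc)
  have := Multiset.mem_add.1 (hKAB c' hc')
  have := Multiset.mem_add.1 (hKAB x hx)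
  grind

theorem BTree.hasCherries_nodes {t : BTree I} (ht : t.leaves.Nodup) :
    HasCherries t.nodes t.leaves := by
  induction t with
  | leaf i =>
    rintro K ⟨c, hc, c', hc', hne⟩ hK
    simp only [leaves, Multiset.mem_singleton] at hK
    exact absurd ((hK c hc).trans (hK c' hc').symm) hne
  | node l r hl hr =>
    obtain ⟨hlnodup, hrnodup, hdisj⟩ := Multiset.nodup_add.1 ht
    refine (hl hlnodup).add (hr hrnodup) (fun p hp x => mem_leaves_of_mem_nodes hp)
      (fun p hp x => mem_leaves_of_mem_nodes hp) (fun p hp => ?_) fun p hp => ?_ <;>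
    rw [nodes, List.mem_cons, List.mem_append] at hp <;>
    rcases hp with rfl | hp | hp
    · exact .inr (notSeparating_left ht)
    · exact .inl hp
    · exact .inr (notSeparating_of_disjoint (fun x => mem_leaves_of_mem_nodes hp) hdisj)
    · exact .inr (notSeparating_right ht)
    · exact .inr (notSeparating_of_disjoint (fun x => mem_leaves_of_mem_nodes hp) hdisj.symm)
    · exact .inl hp

theorem hasCherries_fnodes {w : Drawn I} (hw : (fleaves w).Nodup) :
    HasCherries (fnodes w) (fleaves w) := by
  induction w with
  | nil =>
    rintro K ⟨c, hc, -⟩ hK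
    exact absurd (hK c hc) (Multiset.notMem_zero c)
  | cons t w ih =>
    rw [fleaves_cons] at hw ⊢
    obtain ⟨ht, hw, hdisj⟩ := Multiset.nodup_add.1 hw
    refine (BTree.hasCherries_nodes ht).add (ih hw)
      (fun p hp x => BTree.mem_leaves_of_mem_nodes hp)
      (fun p hp x => mem_fleaves_of_mem_fnodes hp) (fun p hp => ?_) fun p hp => ?_ <;>
    rcases List.mem_append.1 hp with hp | hp
    · exact .inl hp
    · exact .inr (notSeparating_of_disjoint (fun x => mem_fleaves_of_mem_fnodes hp) hdisj)
    · exact .inr (notSeparating_of_disjoint (fun x => BTree.mem_leaves_of_mem_nodes hp) hdisj.symm)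
    · exact .inl hp

end Cherry

/-! ### Paths on four points -/

section PathForm

variable {R V M ι : Type*} [CommRing R] [AddCommGroup V] [Module R V] [AddCommGroup M] [Module R M]

section Alternating

variable {n : Type*} (φ : V [⋀^n]→ₗ[R] M) {v v' : n → V} {i j : n}

theorem alternating_eq_neg (hi : v' i = -v i) (h : ∀ j, j ≠ i → v' j = v j) : φ v' = -φ v := by
  classical
  have hv' : v' = Function.update v i (-v i) := by
    rw [Function.eq_update_iff]; exact ⟨hi, h⟩
  rw [hv', φ.map_update_neg, Function.update_eq_self]

theorem alternating_eq_zero_of_eq_neg (hij : i ≠ j) (h : v i = -v j) : φ v = 0 := by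
  classical
  rw [← Function.update_eq_self i v, h, φ.map_update_neg, φ.map_update_self v hij, neg_zero]

end Alternating

/-- The value of an alternating form on the three edges of the path `f 0, f 1, f 2, f 3`, where
`E a b` is the vector of the edge from `a` to `b`. -/
def pathForm (φ : V [⋀^Fin 3]→ₗ[R] M) (E : ι → ι → V) (f : Fin 4 → ι) : M :=
  φ fun i => E (f i.castSucc) (f i.succ)

/-- The value of an alternating form on the three edges of the triangle `g 0, g 1, g 2`. -/
def triangleForm (φ : V [⋀^Fin 3]→ₗ[R] M) (E : ι → ι → V) (g : Fin 3 → ι) : M :=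
  φ fun i => E (g i) (g (i + 1))

variable (φ : V [⋀^Fin 3]→ₗ[R] M) {E : ι → ι → V} (hE : ∀ a b, E b a = -E a b)
include hE

theorem pathForm_comp_rev (f : Fin 4 → ι) : pathForm φ E (f ∘ Fin.rev) = pathForm φ E f := by
  have hedges : (fun i : Fin 3 => E (f (Fin.rev i.castSucc)) (f (Fin.rev i.succ))) =
      (fun i => (-1 : R) • ((fun i => E (f i.castSucc) (f i.succ)) ∘ Fin.revPerm) i) := by
    funext i
    simp [Fin.rev_castSucc, Fin.rev_succ, hE (f (Fin.castSucc _))]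
  have hsign : Equiv.Perm.sign (Fin.revPerm : Equiv.Perm (Fin 3)) = -1 := by decide
  have hneg := φ.toMultilinearMap.map_smul_univ (fun _ => (-1 : R))
    ((fun i => E (f i.castSucc) (f i.succ)) ∘ Fin.revPerm)
  rw [← hedges, AlternatingMap.coe_multilinearMap, φ.map_perm, hsign] at hneg
  rw [Finset.prod_const, Finset.card_fin, Odd.neg_one_pow (n := 3) (by decide), Units.neg_smul,
    one_smul, neg_one_smul, neg_neg] at hneg
  exact hneg

theorem triangleForm_eq_zero {g : Fin 3 → ι} {m m' : Fin 3} (hm : m ≠ m')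
    (h : ∀ n, n ≠ m → n ≠ m' → E (g n) (g m) = E (g n) (g m')) : triangleForm φ E g = 0 := by
  obtain ⟨n, hnm, hnm', hn⟩ : ∃ n, n ≠ m ∧ n ≠ m' ∧
      (m = n + 1 ∧ m' = n + 2 ∨ m = n + 2 ∧ m' = n + 1) := by
    clear h
    revert m m'
    decide
  have hapex : E (g n) (g (n + 1)) = E (g n) (g (n + 2)) := by
    rcases hn with ⟨rfl, rfl⟩ | ⟨rfl, rfl⟩
    · exact h n hnm hnm'
    · exact (h n hnm hnm').symm
  have hcycle : n + 2 + 1 = n := by omega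
  refine alternating_eq_zero_of_eq_neg φ (i := n) (j := n + 2) (by omega) ?_
  rw [hapex, hcycle, hE (g n), neg_neg]

theorem triangleForm_eq_zero_of_cherry [DecidableEq ι] {g : Fin 3 → ι} (hg : Function.Injective g)
    (h : ∃ c ∈ Finset.univ.image g, ∃ c' ∈ Finset.univ.image g, c ≠ c' ∧
      ∀ x ∈ Finset.univ.image g, x ≠ c → x ≠ c' → E x c = E x c') : triangleForm φ E g = 0 := by
  simp only [Finset.mem_image, Finset.mem_univ, true_and, exists_exists_eq_and,
    forall_exists_index, forall_apply_eq_imp_iff] at h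
  obtain ⟨m, m', hm, h⟩ := h
  exact triangleForm_eq_zero φ hE (ne_of_apply_ne g hm) fun n hn hn' =>
    h n (hg.ne hn) (hg.ne hn')

theorem edge_comp_swap {n : Type*} [DecidableEq n] {f : n → ι} {m m' a b : n}
    (h : ∀ k, k ≠ m → k ≠ m' → E (f k) (f m) = E (f k) (f m')) (hab : a ≠ b)
    (hne : s(a, b) ≠ s(m, m')) :
    E (f (Equiv.swap m m' a)) (f (Equiv.swap m m' b)) = E (f a) (f b) := by
  have h' (k) (hk : k ≠ m) (hk' : k ≠ m') : E (f m) (f k) = E (f m') (f k) := by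
    rw [hE (f k), hE (f k), h k hk hk']
  rw [Ne, Sym2.eq_iff] at hne
  grind

theorem pathForm_comp_swap_of_adjacent {f : Fin 4 → ι} (i : Fin 3)
    (h : ∀ n, n ≠ i.castSucc → n ≠ i.succ → E (f n) (f i.castSucc) = E (f n) (f i.succ)) :
    pathForm φ E (f ∘ Equiv.swap i.castSucc i.succ) = -pathForm φ E f := by
  refine alternating_eq_neg φ (i := i) ?_ fun j hj => ?_
  · simp [hE (f i.castSucc)]
  · refine edge_comp_swap hE h j.castSucc_lt_succ.ne ?_
    simp only [Ne, Sym2.eq_iff, Fin.ext_iff, Fin.val_castSucc, Fin.val_succ] at hj ⊢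
    omega

theorem pathForm_eq_zero_of_not_adjacent {f : Fin 4 → ι} {m m' : Fin 4} (hlt : m < m')
    (hadj : ∀ i : Fin 3, s(i.castSucc, i.succ) ≠ s(m, m'))
    (h : ∀ n, n ≠ m → n ≠ m' → E (f n) (f m) = E (f n) (f m'))
    (htriangle : triangleForm φ E (f ∘ Fin.castSucc) = 0) : pathForm φ E f = 0 := by
  obtain ⟨rfl, rfl⟩ | ⟨rfl, rfl⟩ | ⟨rfl, rfl⟩ :
      (m = 0 ∧ m' = 2) ∨ (m = 1 ∧ m' = 3) ∨ (m = 0 ∧ m' = 3) := by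
    clear h
    revert m m'
    decide
  · exact alternating_eq_zero_of_eq_neg φ (i := 0) (j := 1) (by decide)
      ((hE _ _).trans (congrArg _ (h 1 (by decide) (by decide))))
  · exact alternating_eq_zero_of_eq_neg φ (i := 1) (j := 2) (by decide)
      ((hE _ _).trans (congrArg _ (h 2 (by decide) (by decide))))
  · rw [← htriangle, pathForm, triangleForm]
    congr 1
    funext i
    fin_cases i
    · rfl
    · rfl
    · exact (h 2 (by decide) (by decide)).symm

theorem pathForm_add_comp_swap {f : Fin 4 → ι} {m m' : Fin 4} (hm : m ≠ m')
    (h : ∀ n, n ≠ m → n ≠ m' → E (f n) (f m) = E (f n) (f m'))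
    (htriangle : triangleForm φ E (f ∘ Fin.castSucc) = 0) :
    pathForm φ E f + pathForm φ E (f ∘ Equiv.swap m m') = 0 := by
  wlog hlt : m < m' generalizing m m'
  · rw [Equiv.swap_comm]
    exact this hm.symm (fun n hn hn' => (h n hn' hn).symm) (hm.lt_or_gt.resolve_left hlt)
  by_cases hadj : ∃ i : Fin 3, s(i.castSucc, i.succ) = s(m, m')
  · obtain ⟨i, hi⟩ := hadj
    obtain ⟨rfl, rfl⟩ : i.castSucc = m ∧ i.succ = m' := by
      simp only [Sym2.eq_iff, Fin.ext_iff, Fin.lt_def, Fin.val_castSucc, Fin.val_succ] at hi hlt ⊢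
      omega
    rw [pathForm_comp_swap_of_adjacent φ hE i h, add_neg_cancel]
  · rw [not_exists] at hadj
    have hswap : pathForm φ E (f ∘ Equiv.swap m m') = pathForm φ E f :=
      congrArg φ (funext fun i => edge_comp_swap hE h i.castSucc_lt_succ.ne (hadj i))
    rw [hswap, pathForm_eq_zero_of_not_adjacent φ hE hlt hadj h htriangle, add_zero]

theorem pathForm_add_trans_swap [DecidableEq ι] {K : Finset ι} (f : Fin 4 ≃ K) {c c' : K}
    (hne : c ≠ c') (h : ∀ x : K, x ≠ c → x ≠ c' → E x c = E x c')
    (htriangle : triangleForm φ E (fun n => f n.castSucc) = 0) :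
    pathForm φ E (fun n => f n) + pathForm φ E (fun n => f.trans (Equiv.swap c c') n) = 0 := by
  obtain ⟨m, rfl⟩ := f.surjective c
  obtain ⟨m', rfl⟩ := f.surjective c'
  simp only [Equiv.trans_apply, f.injective.swap_apply]
  exact pathForm_add_comp_swap φ hE (f := fun n => f n) (ne_of_apply_ne f hne)
    (fun n hn hn' => h _ (f.injective.ne hn) (f.injective.ne hn')) htriangle

theorem sum_pathForm_eq_zero [DecidableEq ι] {K : Finset ι} (hK : K.Nontrivial)
    (hcherry : ∀ L ⊆ K, L.Nontrivial → ∃ c ∈ L, ∃ c' ∈ L, c ≠ c' ∧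
      ∀ x ∈ L, x ≠ c → x ≠ c' → E x c = E x c') :
    ∑ f : Fin 4 ≃ K, pathForm φ E (fun n => f n) = 0 := by
  obtain ⟨c, hc, c', hc', hne, h⟩ := hcherry K subset_rfl hK
  lift c to K using hc
  lift c' to K using hc'
  rw [Subtype.coe_ne_coe] at hne
  refine Finset.sum_involution (fun f _ => f.trans (Equiv.swap c c')) (fun f _ => ?_)
    (fun f _ _ hf => ?_) (fun f _ => Finset.mem_univ _) (fun f _ => ?_)
  · refine pathForm_add_trans_swap φ hE f hne (fun x hxc hxc' => h x x.2 (Subtype.coe_ne_coe.2 hxc)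
      (Subtype.coe_ne_coe.2 hxc')) ?_
    have hinj : Function.Injective fun n : Fin 3 => (f n.castSucc : ι) :=
      Subtype.val_injective.comp (f.injective.comp (Fin.castSucc_injective 3))
    refine triangleForm_eq_zero_of_cherry φ hE hinj (hcherry _ ?_ ?_)
    · simp [Finset.subset_iff]
    · exact ⟨f 0, Finset.mem_image_of_mem _ (Finset.mem_univ 0), f 1,
        Finset.mem_image_of_mem _ (Finset.mem_univ 1), hinj.ne (a₁ := 0) (a₂ := 1) (by decide)⟩
  · have hc := DFunLike.congr_fun hf (f.symm c)
    simp [hne.symm] at hc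
  · ext n
    simp

end PathForm

/-! ### Total orders -/

theorem sum_eq_zero_of_xor {α M : Type*} [Fintype α] [AddCommGroup M] [IsAddTorsionFree M]
    {S : Finset α} {ρ : α → α} (hρ : Function.Involutive ρ) (hS : ∀ f, Xor (f ∈ S) (ρ f ∈ S))
    {T : α → M} (hT : ∀ f, T (ρ f) = T f) (h : ∑ f, T f = 0) : ∑ f ∈ S, T f = 0 := by
  classical
  have hcompl : ∑ f ∈ Sᶜ, T f = ∑ f ∈ S, T f := by
    refine Finset.sum_nbij' ρ ρ (fun f hf => ?_) (fun f hf => ?_) (fun f _ => hρ f)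
      (fun f _ => hρ f) fun f _ => (hT f).symm
    · exact (hS f).elim (fun h => absurd h.1 (Finset.mem_compl.1 hf)) And.left
    · exact Finset.mem_compl.2 ((hS f).elim And.right fun h => absurd hf h.2)
  rw [← Finset.sum_add_sum_compl S, hcompl] at h
  exact self_eq_neg.1 (eq_neg_of_add_eq_zero_left h)

section TotalOrders

variable [Fintype I] [DecidableEq I]

theorem exists_alternatingMap_pathForm_eq_times (w : Forest I) :
    ∃ φ : (Fin (fnodes w.1).length → ℚ) [⋀^Fin 3]→ₗ[ℚ] ℚ, ∀ f : Fin 4 → I,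
      times (times (Y (f 0) (f 1)) (Y (f 1) (f 2))) (Y (f 2) (f 3)) (ofForest w) =
        pathForm φ (edgeVec w.1) f := by
  obtain ⟨φ, hφ⟩ := exists_alternatingMap_times_times_Y w
  refine ⟨φ, fun f => (hφ _ _ _ _ _ _).trans (congrArg φ (funext fun i => ?_))⟩
  fin_cases i <;> rfl

theorem times_times_Y_comp_rev (f : Fin 4 → I) (w : Forest I) :
    times (times (Y (f 3) (f 2)) (Y (f 2) (f 1))) (Y (f 1) (f 0)) (ofForest w) =
      times (times (Y (f 0) (f 1)) (Y (f 1) (f 2))) (Y (f 2) (f 3)) (ofForest w) := by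
  obtain ⟨φ, hφ⟩ := exists_alternatingMap_pathForm_eq_times w
  rw [hφ, ← pathForm_comp_rev φ (edgeVec_swap w.1), ← hφ]
  rfl

theorem sum_times_times_Y {K : Finset I} (hK : K.Nontrivial) (w : Forest I) :
    ∑ f : Fin 4 ≃ K, times (times (Y (f 0 : I) (f 1)) (Y (f 1 : I) (f 2))) (Y (f 2 : I) (f 3))
      (ofForest w) = 0 := by
  obtain ⟨φ, hφ⟩ := exists_alternatingMap_pathForm_eq_times w
  have hw : HasCherries (fnodes w.1) (fleaves w.1) :=
    hasCherries_fnodes (w.2.symm ▸ Finset.univ.nodup)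
  refine (Finset.sum_congr rfl fun f _ => hφ fun n => f n).trans
    (sum_pathForm_eq_zero φ (edgeVec_swap w.1) hK fun L _ hL => ?_)
  obtain ⟨c, c', h⟩ := hw L hL fun x _ => w.2.symm ▸ Finset.mem_univ_val x
  exact ⟨c, h.left_mem, c', h.right_mem, h.ne, fun x hx hxc hxc' =>
    funext fun n => h.edgeVal_eq x hx hxc hxc' _ (List.getElem_mem _)⟩

end TotalOrders

end Bessel

end

theorem mainTheorem10 {I : Type*} [Fintype I] [DecidableEq I] (i j k l : I)
    (hdistinct : [i, j, k, l].Nodup)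
    (S : Finset (Fin 4 ≃ ({i, j, k, l} : Finset I)))
    (hS : ∀ f : Fin 4 ≃ ({i, j, k, l} : Finset I), Xor (f ∈ S) (Fin.revPerm.trans f ∈ S)) :
    ∑ f ∈ S, Bessel.times
        (Bessel.times (Bessel.Y (f 0 : I) (f 1 : I)) (Bessel.Y (f 1 : I) (f 2 : I)))
        (Bessel.Y (f 2 : I) (f 3 : I)) = 0 := by
  have hK : ({i, j, k, l} : Finset I).Nontrivial :=
    ⟨i, by simp, j, by simp, List.rel_of_pairwise_cons hdistinct (by simp)⟩
  refine Bessel.bessDual_ext fun w => ?_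
  rw [LinearMap.sum_apply, LinearMap.zero_apply]
  refine Bessel.sum_eq_zero_of_xor (ρ := fun f => Fin.revPerm.trans f) (fun f => ?_) hS
    (fun f => ?_) (Bessel.sum_times_times_Y hK w)
  · ext m
    simp
  · exact Bessel.times_times_Y_comp_rev (fun n => (f n : I)) w
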